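/- Let $K$ be an algebraically closed field of characteristic $0$, let $n,d$ be integers with $2\le d<n$ and $\gcd(n,d)=1$, and let $f(x)\in K[x]$ be a polynomial of degree $n$ without repeated roots. Let $\mathcal C_{f,d}$ be the smooth projective model of the affine curve $y^d=f(x)$ and let $\mathcal O$ be its unique point at infinity (the only pole of $x$). Embed $\mathcal C_{f,d}$ in its Jacobian by $P\mapsto[(P)-(\mathcal O)]$; the order of a point $P$ is the order of its image. The group $\mu_d$ of $d$-th roots of unity in $K$ acts on $\mathcal C_{f,d}$ by $\zeta\cdot(x,y)=(x,\zeta y)$; for an integer $m>1$, an $m$-packet is a $\mu_d$-orbit with more than one element, all of whose points are torsion points of order $m$. Put $$\ell_0=\left\lfloor \frac{n+d}{d}\right\rfloor,\qquad m_0=d\,\ell_0 .$$ Suppose that $n-m_0+\ell_0\ge 0$ and $m_0\ne n+1$, and that $\mathcal C_{f,d}$ has at least two distinct $m_0$-packets. Then: (i) $d\le 5$; (ii) if $n<2d$, then $d\le 4$, $m_0=2d$ and $n\le 7$; (iii) if $n=7$, then $d=3$; (iv) $n\ne 5$ and $n\ne 6$; (v) if $n=4$, then $d=3$; (vi) if $n=9$,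 then $d=4$. -/

import Mathlib

open Polynomial

namespace AlgCurve

/-! ### Points, divisors and the Jacobian of the smooth projective model of a function field

Throughout, `K` is an algebraically closed field and `F / K` a function field in one variable.
The smooth projective curve with function field `F` is the set of all discrete valuation rings
of `F / K`. -/

/-- A closed point of the smooth projective model of `F / K`: a discrete valuation ring of `F`
which contains `K` (and has fraction field `F`). -/
@[ext]
structure Place (K F : Type*) [Field K] [Field F] [Algebra K F] where
  /-- the local ring at the point -/
  localRing : ValuationSubring F
  algebraMap_mem : ∀ c : K, algebraMap K F c ∈ localRing
  isDVR : IsDiscreteValuationRing localRing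

variable {K F : Type*} [Field K] [Field F] [Algebra K F]

/-- The order of vanishing at `P` of a function `h` (`0` by convention if `h = 0`). -/
noncomputable def Place.ord (P : Place K F) (h : F) : ℤ :=
  haveI := P.isDVR;
  -WithZero.log ((IsDiscreteValuationRing.maximalIdeal P.localRing).valuation F h)

theorem Place.ord_one (P : Place K F) : P.ord 1 = 0 := by
  simp [Place.ord]

theorem Place.ord_mul (P : Place K F) {g h : F} (hg : g ≠ 0) (hh : h ≠ 0) :
    P.ord (g * h) = P.ord g + P.ord h := by
  have := P.isDVR
  simp only [Place.ord, map_mul]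
  rw [WithZero.log_mul (by simpa using hg) (by simpa using hh)]
  ring

theorem Place.ord_inv (P : Place K F) (h : F) : P.ord h⁻¹ = -P.ord h := by
  simp only [Place.ord, map_inv₀, WithZero.log_inv]

/-- The image of a point under the automorphism of the curve given by `σ`: a function `h` is
regular at `σ P` iff `σ⁻¹ h` is regular at `P`. -/
def Place.map (σ : F ≃ₐ[K] F) (P : Place K F) : Place K F where
  localRing := P.localRing.comap (σ.symm : F →+* F)
  algebraMap_mem c := by
    simpa [ValuationSubring.mem_comap] using P.algebraMap_mem c
  isDVR := by
    have := P.isDVR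
    let e : P.localRing ≃+* P.localRing.comap (σ.symm : F →+* F) :=
      { toFun := fun a => ⟨σ a, by simp [ValuationSubring.mem_comap]⟩
        invFun := fun a => ⟨σ.symm a, a.2⟩
        left_inv := fun a => by simp
        right_inv := fun a => by simp
        map_mul' := fun a b => by ext; simp
        map_add' := fun a b => by ext; simp }
    exact IsDiscreteValuationRing.RingEquivClass.isDiscreteValuationRing e

instance : MulAction (F ≃ₐ[K] F) (Place K F) where
  smul σ P := P.map σ
  one_smul P := by
    apply Place.ext
    ext a
    change (1 : F ≃ₐ[K] F).symm a ∈ P.localRing ↔ a ∈ P.localRing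
    rfl
  mul_smul σ τ P := by
    apply Place.ext
    ext a
    change (σ * τ).symm a ∈ P.localRing ↔ τ.symm (σ.symm a) ∈ P.localRing
    rfl

variable (K F)

/-- The group of divisors. -/
abbrev Divisor := Place K F →₀ ℤ

/-- The degree of a divisor (all residue fields equal `K`, as `K` is algebraically closed). -/
noncomputable def Divisor.deg : Divisor K F →+ ℤ :=
  Finsupp.liftAddHom fun _ => AddMonoidHom.id ℤ

/-- The group of divisors of degree zero. -/
noncomputable abbrev DivisorZero : AddSubgroup (Divisor K F) := (Divisor.deg K F).ker

/-- The group of principal divisors `div(h)`, `h ∈ Fˣ`. -/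
def principalDivisors : AddSubgroup (Divisor K F) where
  carrier := {D | ∃ h : F, h ≠ 0 ∧ ∀ P : Place K F, D P = P.ord h}
  zero_mem' := ⟨1, one_ne_zero, fun P => by simp [Place.ord_one]⟩
  add_mem' := by
    rintro D E ⟨g, hg, hD⟩ ⟨h, hh, hE⟩
    exact ⟨g * h, mul_ne_zero hg hh, fun P => by
      rw [Finsupp.add_apply, hD, hE, Place.ord_mul P hg hh]⟩
  neg_mem' := by
    rintro D ⟨g, hg, hD⟩
    exact ⟨g⁻¹, inv_ne_zero hg, fun P => by rw [Finsupp.neg_apply, hD, Place.ord_inv]⟩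

/-- The group of `K`-points of the Jacobian: divisors of degree zero modulo principal divisors
(of degree zero, as all principal divisors are). -/
abbrev Jacobian : Type _ :=
  DivisorZero K F ⧸ (principalDivisors K F).addSubgroupOf (DivisorZero K F)

variable {K F}

/-- The canonical embedding `P ↦ [(P) - (O)]` of the curve into its Jacobian. -/
noncomputable def toJacobian (O P : Place K F) : Jacobian K F :=
  QuotientAddGroup.mk
    ⟨Finsupp.single P 1 - Finsupp.single O 1, by
      rw [AddMonoidHom.mem_ker, map_sub]; simp [Divisor.deg]⟩

end AlgCurve

open AlgCurve

/-- The data of a curve `y ^ d = f(x)` as considered here: `2 ≤ d < n`, `(n, d) = 1`,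
`char K ∤ d`, and `f` is a polynomial of degree `n` without repeated roots. -/
structure CyclicCover (K : Type*) [Field K] where
  n : ℕ
  d : ℕ
  f : K[X]
  two_le_d : 2 ≤ d
  d_lt_n : d < n
  coprime : n.Coprime d
  d_cast_ne_zero : (d : K) ≠ 0
  natDegree_f : f.natDegree = n
  nodup_roots : f.roots.Nodup

namespace CyclicCover

variable {K : Type*} [Field K] (C : CyclicCover K)

/-- The polynomial `Y ^ d - f(X)` in `K[X][Y]`. -/
noncomputable def equation : K[X][X] := X ^ C.d - Polynomial.C C.f

theorem d_ne_zero : C.d ≠ 0 := by have := C.two_le_d; omega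

theorem monic_equation : C.equation.Monic :=
  monic_X_pow_sub_C _ C.d_ne_zero

theorem eval₂_equation {R : Type*} [CommRing R] (φ : K[X] →+* R) (z : R) :
    C.equation.eval₂ φ z = z ^ C.d - φ C.f := by
  simp [equation]

/-- The coordinate ring `K[x, y] = K[X, Y] / (Y ^ d - f(X))` of the affine curve
`y ^ d = f(x)`. -/
abbrev CoordinateRing : Type _ := AdjoinRoot C.equation

section

variable [IsAlgClosed K]

/-- The Eisenstein criterion at a root of `f`. -/
theorem irreducible_equation : Irreducible C.equation := by
  classical
  have hn : 0 < C.f.natDegree := by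
    have := C.natDegree_f; have := C.d_lt_n; omega
  have hf0 : C.f ≠ 0 := by rintro h; simp [h] at hn
  obtain ⟨a, ha⟩ := IsAlgClosed.exists_root C.f (by
    intro h
    rw [natDegree_pos_iff_degree_pos, h] at hn
    exact lt_irrefl _ hn)
  have hP : (Ideal.span {(X - Polynomial.C a : K[X])}).IsPrime :=
    (Ideal.span_singleton_prime (X_sub_C_ne_zero a)).2 (prime_X_sub_C a)
  have hdvd : (X - Polynomial.C a) ∣ C.f := dvd_iff_isRoot.2 ha
  have hsq : ¬ (X - Polynomial.C a) ^ 2 ∣ C.f := by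
    rw [← le_rootMultiplicity_iff hf0, ← count_roots]
    have := Multiset.nodup_iff_count_le_one.1 C.nodup_roots a
    omega
  have hdeg : C.equation.degree = C.d := degree_X_pow_sub_C (Nat.pos_of_ne_zero C.d_ne_zero) _
  refine irreducible_of_eisenstein_criterion hP ?_ ?_ ?_ ?_ C.monic_equation.isPrimitive
  · rw [C.monic_equation.leadingCoeff, ← Ideal.eq_top_iff_one]
    exact hP.ne_top
  · intro k hk
    rw [hdeg, Nat.cast_lt] at hk
    rw [equation, coeff_sub, coeff_X_pow, if_neg hk.ne, zero_sub, neg_mem_iff, coeff_C]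
    split_ifs
    · exact Ideal.mem_span_singleton.2 hdvd
    · exact zero_mem _
  · rw [hdeg]; exact_mod_cast Nat.pos_of_ne_zero C.d_ne_zero
  · rw [equation, coeff_sub, coeff_X_pow, if_neg C.d_ne_zero.symm, zero_sub, neg_mem_iff,
      coeff_C_zero, Ideal.span_singleton_pow, Ideal.mem_span_singleton]
    exact hsq

instance : IsDomain C.CoordinateRing :=
  AdjoinRoot.isDomain_of_prime C.irreducible_equation.prime

end

/-- The field `K(x, y)` of rational functions on the curve. -/
abbrev FunctionField : Type _ := FractionRing C.CoordinateRing

/-- The coordinate function `x`. -/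
noncomputable def x : C.FunctionField :=
  algebraMap C.CoordinateRing C.FunctionField (AdjoinRoot.of C.equation X)

/-- The coordinate function `y`. -/
noncomputable def y : C.FunctionField :=
  algebraMap C.CoordinateRing C.FunctionField (AdjoinRoot.root C.equation)

theorem y_pow : C.y ^ C.d = aeval C.x C.f := by
  have h : AdjoinRoot.root C.equation ^ C.d = AdjoinRoot.of C.equation C.f := by
    have := AdjoinRoot.eval₂_root C.equation
    rwa [eval₂_equation, sub_eq_zero] at this
  have h2 : AdjoinRoot.of C.equation C.f = aeval (AdjoinRoot.of C.equation X) C.f := by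
    rw [show AdjoinRoot.of C.equation = algebraMap K[X] C.CoordinateRing from rfl,
      aeval_algebraMap_apply, aeval_X_left_apply]
  rw [y, ← map_pow, h, h2, x, aeval_algebraMap_apply]

theorem transcendental_x : Transcendental K C.x := by
  have h1 : Function.Injective (algebraMap C.CoordinateRing C.FunctionField) :=
    IsFractionRing.injective _ _
  have h2 : Function.Injective (AdjoinRoot.of C.equation) := by
    apply AdjoinRoot.of.injective_of_degree_ne_zero
    rw [equation, degree_X_pow_sub_C (Nat.pos_of_ne_zero C.d_ne_zero)]
    exact_mod_cast C.d_ne_zero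
  rw [transcendental_iff]
  intro p hp
  apply h2
  rw [x, aeval_algebraMap_apply, map_eq_zero_iff _ h1,
    show AdjoinRoot.of C.equation = algebraMap K[X] C.CoordinateRing from rfl,
    aeval_algebraMap_apply, aeval_X_left_apply] at hp
  rw [map_zero]; exact hp

/-- The endomorphism `x ↦ x`, `y ↦ ζ⁻¹ y` of the coordinate ring. -/
noncomputable def scaleHom (ζ : rootsOfUnity C.d K) : C.CoordinateRing →ₐ[K] C.CoordinateRing :=
  AdjoinRoot.liftAlgHom C.equation (IsScalarTower.toAlgHom K K[X] C.CoordinateRing)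
    (((ζ⁻¹ : rootsOfUnity C.d K) : Kˣ) • AdjoinRoot.root C.equation) (by
      have h := AdjoinRoot.eval₂_root C.equation
      rw [eval₂_equation] at h ⊢
      rw [_root_.smul_pow, (mem_rootsOfUnity _ _).1 (ζ⁻¹).2, one_smul]
      exact h)

theorem scaleHom_of (ζ : rootsOfUnity C.d K) (g : K[X]) :
    C.scaleHom ζ (AdjoinRoot.of C.equation g) = AdjoinRoot.of C.equation g := by
  rw [scaleHom, AdjoinRoot.liftAlgHom_of]; rfl

theorem scaleHom_root (ζ : rootsOfUnity C.d K) :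
    C.scaleHom ζ (AdjoinRoot.root C.equation) =
      ((ζ⁻¹ : rootsOfUnity C.d K) : Kˣ) • AdjoinRoot.root C.equation := by
  rw [scaleHom, AdjoinRoot.liftAlgHom_root]

theorem hom_ext {φ ψ : C.CoordinateRing →ₐ[K] C.CoordinateRing}
    (h : ∀ g, φ (AdjoinRoot.of C.equation g) = ψ (AdjoinRoot.of C.equation g))
    (hr : φ (AdjoinRoot.root C.equation) = ψ (AdjoinRoot.root C.equation)) : φ = ψ := by
  have : (φ : C.CoordinateRing →+* C.CoordinateRing) = ψ :=
    AdjoinRoot.ringHom_ext (RingHom.ext h) hr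
  exact AlgHom.ext fun a => RingHom.congr_fun this a

theorem scaleHom_one : C.scaleHom 1 = AlgHom.id K _ :=
  C.hom_ext (fun g => by rw [scaleHom_of]; rfl) (by rw [scaleHom_root]; simp)

theorem scaleHom_mul (ζ ξ : rootsOfUnity C.d K) :
    C.scaleHom (ζ * ξ) = (C.scaleHom ζ).comp (C.scaleHom ξ) :=
  C.hom_ext (fun g => by simp only [AlgHom.comp_apply, scaleHom_of]) (by
    rw [AlgHom.comp_apply, scaleHom_root, scaleHom_root, Units.smul_def, Units.smul_def, map_smul,
      scaleHom_root, Units.smul_def, smul_smul]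
    congr 1)

/-- The automorphism `x ↦ x`, `y ↦ ζ⁻¹ y` of the coordinate ring. -/
noncomputable def scale (ζ : rootsOfUnity C.d K) : C.CoordinateRing ≃ₐ[K] C.CoordinateRing :=
  AlgEquiv.ofAlgHom (C.scaleHom ζ) (C.scaleHom ζ⁻¹)
    (by rw [← scaleHom_mul, mul_inv_cancel, scaleHom_one])
    (by rw [← scaleHom_mul, inv_mul_cancel, scaleHom_one])

section

variable [IsAlgClosed K]

/-- The automorphisms `x ↦ x`, `y ↦ ζ⁻¹ y` of the function field, for `ζ ∈ μ_d`. On points this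
is `(a, b) ↦ (a, ζ b)`. -/
noncomputable def muHom :
    rootsOfUnity C.d K →* (C.FunctionField ≃ₐ[K] C.FunctionField) where
  toFun ζ := IsFractionRing.algEquivOfAlgEquiv (C.scale ζ)
  map_one' := by
    ext h
    obtain ⟨a, b, -, rfl⟩ := IsFractionRing.div_surjective C.CoordinateRing h
    simp [scale, scaleHom_one]
  map_mul' ζ ξ := by
    ext h
    obtain ⟨a, b, -, rfl⟩ := IsFractionRing.div_surjective C.CoordinateRing h
    simp [scale, scaleHom_mul]

theorem muHom_x (ζ : rootsOfUnity C.d K) : C.muHom ζ C.x = C.x := by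
  simp [muHom, x, scale, scaleHom_of]

theorem muHom_y (ζ : rootsOfUnity C.d K) :
    C.muHom ζ C.y = ((ζ⁻¹ : rootsOfUnity C.d K) : Kˣ) • C.y := by
  have h : C.muHom ζ C.y = algebraMap C.CoordinateRing C.FunctionField
      (C.scaleHom ζ (AdjoinRoot.root C.equation)) := by
    simp [muHom, y, scale]
  rw [h, scaleHom_root, y, Units.smul_def, Units.smul_def, Algebra.smul_def, Algebra.smul_def,
    map_mul, ← IsScalarTower.algebraMap_apply]

/-- The `K`-points of the smooth projective model of `y ^ d = f(x)`. -/
abbrev Point : Type _ := Place K C.FunctionField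

/-- The action of `μ_d` on the curve. -/
noncomputable instance : MulAction (rootsOfUnity C.d K) C.Point :=
  MulAction.compHom C.Point C.muHom

/-- A valuation ring of the function field containing `K` but not `x`. -/
def IsPole (V : ValuationSubring C.FunctionField) : Prop :=
  (∀ c : K, algebraMap K C.FunctionField c ∈ V) ∧ C.x ∉ V

theorem exists_isPole : ∃ V, C.IsPole V := by
  have hx : C.x ∉ (integralClosure K C.FunctionField).toSubring := fun h =>
    C.transcendental_x (IsIntegral.isAlgebraic h)
  have : IsIntegrallyClosedIn (integralClosure K C.FunctionField).toSubring C.FunctionField :=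
    inferInstanceAs (IsIntegrallyClosedIn (integralClosure K C.FunctionField) C.FunctionField)
  obtain ⟨V, hV, hxV⟩ := Subring.exists_le_valuationSubring_of_isIntegrallyClosedIn hx
  exact ⟨V, fun c => hV (algebraMap_mem (integralClosure K C.FunctionField) c), hxV⟩

variable {C} in
theorem IsPole.valuation_aeval {V : ValuationSubring C.FunctionField} (hV : C.IsPole V)
    {g : K[X]} (hg : g ≠ 0) :
    V.valuation (aeval C.x g) = V.valuation C.x ^ g.natDegree := by
  have hx : 1 < V.valuation C.x := by
    rw [← not_le, V.valuation_le_one_iff]; exact hV.2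
  have : V.valuation.IsTrivialOn K := ⟨fun a ha => by
    refine le_antisymm ((V.valuation_le_one_iff _).2 (hV.1 a)) ?_
    have := (V.valuation_le_one_iff _).2 (hV.1 a⁻¹)
    rw [map_inv₀, map_inv₀] at this
    exact (inv_le_one₀ (by simpa [zero_lt_iff] using ha)).1 this⟩
  exact valuation_aeval_eq_valuation_X_pow_natDegree_of_one_lt_valuation_X _ hx hg

theorem exists_uniformizer : ∃ t : C.FunctionField, ∀ V, C.IsPole V →
    V.valuation t < 1 ∧ V.valuation t ≠ 0 ∧ V.valuation C.x = V.valuation t ^ (-(C.d : ℤ)) ∧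
      V.valuation C.y = V.valuation t ^ (-(C.n : ℤ)) := by
  obtain ⟨a, b, hab⟩ := Nat.isCoprime_iff_coprime.2 C.coprime
  refine ⟨C.x ^ (-b) * C.y ^ (-a), fun V hV => ?_⟩
  have hx : 1 < V.valuation C.x := by
    rw [← not_le, V.valuation_le_one_iff]; exact hV.2
  have hx0 : V.valuation C.x ≠ 0 := (zero_lt_one.trans hx).ne'
  have hf0 : C.f ≠ 0 := by
    intro h
    have := C.natDegree_f; have := C.d_lt_n; simp [h] at *; omega
  have hy : V.valuation C.y ^ (C.d : ℤ) = V.valuation C.x ^ (C.n : ℤ) := by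
    rw [zpow_natCast, zpow_natCast, ← map_pow, y_pow, hV.valuation_aeval hf0, C.natDegree_f]
  have hy0 : V.valuation C.y ≠ 0 := by
    intro h
    rw [h, zpow_natCast, zero_pow C.d_ne_zero] at hy
    exact zpow_ne_zero _ hx0 hy.symm
  set X := V.valuation C.x
  set Y := V.valuation C.y
  have ht : V.valuation (C.x ^ (-b) * C.y ^ (-a)) = X ^ (-b) * Y ^ (-a) := by
    simp only [map_mul, map_zpow₀, X, Y]
  rw [ht]
  have h1 : X = (X ^ (-b) * Y ^ (-a)) ^ (-(C.d : ℤ)) := by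
    rw [mul_zpow, ← zpow_mul, ← zpow_mul,
      show -a * -(C.d : ℤ) = C.d * a by ring, zpow_mul Y, hy, ← zpow_mul, ← zpow_add₀ hx0,
      show -b * -(C.d : ℤ) + C.n * a = 1 by linarith, zpow_one]
  have h2 : Y = (X ^ (-b) * Y ^ (-a)) ^ (-(C.n : ℤ)) := by
    rw [mul_zpow, ← zpow_mul, ← zpow_mul,
      show -b * -(C.n : ℤ) = C.n * b by ring, zpow_mul X, ← hy, ← zpow_mul, ← zpow_add₀ hy0,
      show C.d * b + -a * -(C.n : ℤ) = 1 by linarith, zpow_one]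
  refine ⟨?_, mul_ne_zero (zpow_ne_zero _ hx0) (zpow_ne_zero _ hy0), h1, h2⟩
  by_contra hlt
  rw [not_lt] at hlt
  rw [h1, zpow_neg, zpow_natCast] at hx
  exact absurd hx (not_lt.2 (inv_le_one_of_one_le₀ (one_le_pow₀ hlt)))

theorem exists_valuation_sum {t : C.FunctionField} (ht : ∀ V, C.IsPole V →
    V.valuation t < 1 ∧ V.valuation t ≠ 0 ∧ V.valuation C.x = V.valuation t ^ (-(C.d : ℤ)) ∧
      V.valuation C.y = V.valuation t ^ (-(C.n : ℤ))) (p : ℕ → K[X]) (s : Finset ℕ)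
    (hs : ∀ i ∈ s, i < C.d) :
    (∀ i ∈ s, p i = 0) ∨ ∃ i ∈ s, ∃ m : ℕ, ∀ V, C.IsPole V →
      V.valuation (∑ i ∈ s, aeval C.x (p i) * C.y ^ i) =
        V.valuation t ^ (-((C.d : ℤ) * m + C.n * i)) := by
  classical
  induction s using Finset.induction_on with
  | empty => simp
  | insert j s hj ih =>
    have ih := ih fun i hi => hs i (Finset.mem_insert_of_mem hi)
    have hterm : p j ≠ 0 → ∀ V, C.IsPole V → V.valuation (aeval C.x (p j) * C.y ^ j) =
        V.valuation t ^ (-((C.d : ℤ) * (p j).natDegree + C.n * j)) := by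
      intro hp V hV
      obtain ⟨-, h0, hx, hy⟩ := ht V hV
      rw [map_mul, map_pow, hV.valuation_aeval hp, hx, hy, ← zpow_natCast, ← zpow_natCast,
        ← zpow_mul, ← zpow_mul, ← zpow_add₀ h0]
      congr 1; ring
    by_cases hp : p j = 0
    · rcases ih with ih | ⟨i, hi, m, h⟩
      · left
        intro i hi
        rcases Finset.mem_insert.1 hi with rfl | hi
        exacts [hp, ih i hi]
      · refine Or.inr ⟨i, Finset.mem_insert_of_mem hi, m, fun V hV => ?_⟩
        rw [Finset.sum_insert hj, hp, map_zero, zero_mul, zero_add]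
        exact h V hV
    · right
      have hterm := hterm hp
      rcases ih with ih | ⟨i, hi, m, h⟩
      · refine ⟨j, Finset.mem_insert_self _ _, (p j).natDegree, fun V hV => ?_⟩
        rw [Finset.sum_insert hj, Finset.sum_eq_zero (s := s), add_zero]
        · exact hterm V hV
        · intro i hi
          rw [ih i hi, map_zero, zero_mul]
      · set k := (p j).natDegree
        have hij : i ≠ j := fun h => hj (h ▸ hi)
        have hne : (C.d : ℤ) * k + C.n * j ≠ C.d * m + C.n * i := by
          intro h
          have hmod : C.n * j ≡ C.n * i [MOD C.d] := by
            rw [Nat.modEq_iff_dvd]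
            exact ⟨k - m, by push_cast; linarith⟩
          have := Nat.ModEq.cancel_left_of_coprime
            (by rw [Nat.gcd_comm]; exact C.coprime) hmod
          exact hij (Nat.ModEq.eq_of_lt_of_lt this (hs j (Finset.mem_insert_self _ _))
            (hs i (Finset.mem_insert_of_mem hi))).symm
        rcases lt_or_gt_of_ne hne with hlt | hlt
        · refine ⟨i, Finset.mem_insert_of_mem hi, m, fun V hV => ?_⟩
          obtain ⟨h1, h0, -⟩ := ht V hV
          rw [Finset.sum_insert hj, Valuation.map_add_eq_of_lt_right, h V hV]
          rw [h V hV, hterm V hV]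
          exact zpow_lt_zpow_right_of_lt_one₀ (zero_lt_iff.2 h0) h1 (by linarith)
        · refine ⟨j, Finset.mem_insert_self _ _, k, fun V hV => ?_⟩
          obtain ⟨h1, h0, -⟩ := ht V hV
          rw [Finset.sum_insert hj, Valuation.map_add_eq_of_lt_left, hterm V hV]
          rw [h V hV, hterm V hV]
          exact zpow_lt_zpow_right_of_lt_one₀ (zero_lt_iff.2 h0) h1 (by linarith)

theorem exists_valuation_eq : ∃ t : C.FunctionField,
    (∀ V, C.IsPole V → V.valuation t < 1 ∧ V.valuation t ≠ 0) ∧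
    ∀ h : C.FunctionField, h ≠ 0 → ∃ k : ℤ, ∀ V, C.IsPole V →
      V.valuation h = V.valuation t ^ k := by
  obtain ⟨t, ht⟩ := C.exists_uniformizer
  refine ⟨t, fun V hV => ⟨(ht V hV).1, (ht V hV).2.1⟩, ?_⟩
  have key : ∀ a : C.CoordinateRing, a ≠ 0 → ∃ k : ℤ, ∀ V, C.IsPole V →
      V.valuation (algebraMap _ C.FunctionField a) = V.valuation t ^ k := by
    intro a ha
    obtain ⟨q, rfl⟩ := AdjoinRoot.mk_surjective a
    rw [show AdjoinRoot.mk C.equation q = AdjoinRoot.mk C.equation (q %ₘ C.equation) by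
      rw [AdjoinRoot.mk_eq_mk]
      exact ⟨q /ₘ C.equation, by
        rw [sub_eq_iff_eq_add', modByMonic_add_div]⟩] at ha ⊢
    set p := q %ₘ C.equation
    have hdeg : p.natDegree < C.d := by
      have h := natDegree_modByMonic_lt q C.monic_equation (by
        intro h
        have := congrArg natDegree h
        rw [equation, natDegree_X_pow_sub_C, natDegree_one] at this
        exact C.d_ne_zero this)
      rwa [show C.equation.natDegree = C.d from natDegree_X_pow_sub_C] at h
    have hsum : algebraMap _ C.FunctionField (AdjoinRoot.mk C.equation p) =
        ∑ i ∈ Finset.range C.d, aeval C.x (p.coeff i) * C.y ^ i := by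
      conv_lhs => rw [p.as_sum_range' _ hdeg]
      simp only [map_sum]
      refine Finset.sum_congr rfl fun i _ => ?_
      rw [← C_mul_X_pow_eq_monomial, map_mul, map_pow, AdjoinRoot.mk_C, AdjoinRoot.mk_X, map_mul,
        map_pow, y, x, aeval_algebraMap_apply,
        show AdjoinRoot.of C.equation = algebraMap K[X] C.CoordinateRing from rfl,
        aeval_algebraMap_apply, aeval_X_left_apply]
    rcases C.exists_valuation_sum ht p.coeff (Finset.range C.d)
      (fun i hi => Finset.mem_range.1 hi) with h | ⟨i, -, m, h⟩
    · refine absurd ?_ ha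
      have : p = 0 := by
        ext1 i
        by_cases hi : i < C.d
        · rw [h i (Finset.mem_range.2 hi), coeff_zero]
        · rw [coeff_eq_zero_of_natDegree_lt (by omega), coeff_zero]
      rw [this, map_zero]
    · exact ⟨_, fun V hV => by rw [hsum]; exact h V hV⟩
  intro h hh
  obtain ⟨a, b, hb, rfl⟩ := IsFractionRing.div_surjective C.CoordinateRing h
  have hb0 : b ≠ 0 := nonZeroDivisors.ne_zero hb
  have ha0 : a ≠ 0 := by rintro rfl; simp at hh
  obtain ⟨k, hk⟩ := key a ha0
  obtain ⟨l, hl⟩ := key b hb0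
  exact ⟨k - l, fun V hV => by
    rw [map_div₀, hk V hV, hl V hV, zpow_sub₀ ((ht V hV).2.1)]⟩

/-- There is exactly one point at infinity, i.e. exactly one pole of `x`. -/
theorem existsUnique_infinity : ∃! O : C.Point, C.x ∉ O.localRing := by
  obtain ⟨t, ht, h⟩ := C.exists_valuation_eq
  obtain ⟨V, hV⟩ := C.exists_isPole
  obtain ⟨ht1, ht0⟩ := ht V hV
  have hmem : ∀ {k : ℤ} {V}, C.IsPole V → (V.valuation t ^ k ≤ 1 ↔ 0 ≤ k) := by
    intro k V hV
    obtain ⟨ht1, ht0⟩ := ht V hV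
    rw [← zpow_zero (V.valuation t)]
    exact zpow_le_zpow_iff_right_of_lt_one₀ (zero_lt_iff.2 ht0) ht1
  have hdvr : IsDiscreteValuationRing V := by
    apply IsDiscreteValuationRing.ofHasUnitMulPowIrreducibleFactorization
    let T : V := ⟨t, (V.valuation_le_one_iff t).1 ht1.le⟩
    have hpow : ∀ {a : V}, a ≠ 0 → ∃ k : ℕ, V.valuation (a : C.FunctionField) =
        V.valuation t ^ k := by
      intro a ha
      obtain ⟨k, hk⟩ := h a (by simpa using ha)
      have hk := hk V hV
      have h1 := V.valuation_le_one a
      rw [hk, hmem hV] at h1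
      lift k to ℕ using h1
      exact ⟨k, by rw [hk, zpow_natCast]⟩
    refine ⟨T, ⟨?_, ?_⟩, ?_⟩
    · rw [V.valuation_eq_one_iff]; exact ht1.ne
    · intro a b hab
      have hab' : t = a * b := congrArg Subtype.val hab
      have htne : t ≠ 0 := by rintro rfl; simp at ht0
      have ha : a ≠ 0 := by rintro rfl; simp at hab'; exact htne hab'
      have hb : b ≠ 0 := by rintro rfl; simp at hab'; exact htne hab'
      obtain ⟨k, hk⟩ := hpow ha
      obtain ⟨l, hl⟩ := hpow hb
      have hkl : V.valuation t ^ (k + l) = V.valuation t ^ 1 := by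
        rw [pow_add, ← hk, ← hl, ← map_mul, ← hab', pow_one]
      have : k + l = 1 := (pow_right_strictAnti₀ (zero_lt_iff.2 ht0) ht1).injective hkl
      rw [V.valuation_eq_one_iff, V.valuation_eq_one_iff, hk, hl]
      rcases Nat.eq_zero_or_pos k with rfl | hk0
      · left; simp
      · right; rw [show l = 0 by omega]; simp
    · intro a ha
      obtain ⟨k, hk⟩ := hpow ha
      refine ⟨k, ?_⟩
      rw [← map_pow, eq_comm] at hk
      obtain ⟨u, hu⟩ := (V.valuation_eq_iff _ _).1 hk.symm
      refine ⟨u, Subtype.ext ?_⟩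
      rw [← hu, mul_comm]; rfl
  refine ⟨⟨V, hV.1, hdvr⟩, hV.2, ?_⟩
  intro P hP
  have hPp : C.IsPole P.localRing := ⟨P.algebraMap_mem, hP⟩
  apply Place.ext
  ext a
  by_cases ha : a = 0
  · simp [ha, zero_mem]
  · obtain ⟨k, hk⟩ := h a ha
    rw [← ValuationSubring.valuation_le_one_iff, ← ValuationSubring.valuation_le_one_iff,
      hk _ hPp, hk _ hV, hmem hPp, hmem hV]

/-- The point at infinity `O`: the only point of the curve at which `x` is not regular. -/
noncomputable def infinity : C.Point := C.existsUnique_infinity.choose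

theorem eq_infinity_iff (P : C.Point) : P = C.infinity ↔ C.x ∉ P.localRing :=
  ⟨fun h => h ▸ C.existsUnique_infinity.choose_spec.1,
    fun h => C.existsUnique_infinity.choose_spec.2 P h⟩

/-- The order of a point in the Jacobian, the curve being embedded with `O ↦ 0` (it is `0` if
the point is not a torsion point). -/
noncomputable def order (P : C.Point) : ℕ := addOrderOf (toJacobian C.infinity P)

/-- An `m`-packet: a nontrivial `μ_d`-orbit consisting of torsion points of order `m`. -/
def IsPacket (m : ℕ) (S : Set C.Point) : Prop :=
  (∃ P : C.Point, S = MulAction.orbit (rootsOfUnity C.d K) P) ∧ S.Nontrivial ∧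
    ∀ P ∈ S, C.order P = m

end

/-- `ℓ₀ = ⌊(n + d) / d⌋`. -/
def l₀ : ℕ := (C.n + C.d) / C.d

/-- `m₀ = ℓ₀ d`. -/
def m₀ : ℕ := C.l₀ * C.d

end CyclicCover

/-! If `P` has order `m₀`, then `m₀ P - m₀ O = div h` with `h` regular off `O`. Functions regular
off `O` are polynomials in `x` and `y`, where `x` and `y` have poles at `O` of orders proportional
to `d` and `n`. Since `n < m₀ < n + d < 2n`, a pole of order `m₀` leaves only `h = c (y - v(x))`
with `deg v = l₀`, once `h` is not `μ_d`-invariant. Every zero of a conjugate of `h` lies in the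
orbit of `P`, so the norm `v ^ d - f` has the single root `a = x(P)`, and `v ^ d = f + s (x - a) ^
m₀` (`exists_of_nontrivial_orbit`).

Two packets give two such identities, `u ^ d = f + s (x - a) ^ m₀` and `v ^ d = f + t (x - b) ^ m₀`
with `a ≠ b`. The Wronskian of `f`, `(x - b) ^ m₀`, `(x - a) ^ m₀` is, up to constants, also that of
`u ^ d`, `v ^ d` and either power, so `u ^ (d - 2) * v ^ (d - 2)` divides it together with both
powers lowered by two. Written out, it is those two lowered powers times a nonzero polynomial of
degree at most `n`. Hence `2 (d - 2) l₀ ≤ n ≤ d l₀ - 2`, which forces `d < 4`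
(`lt_four_of_pow_sub_pow`). The case `d = 2` would give `m₀ = n + 1`, so `d = 3` and `n ≡ 1 mod 3`;
all the claims follow, some vacuously. -/

/-! ### Wronskians and the bound on the exponent. -/

/-- The Wronskian determinant of three polynomials. -/
noncomputable def wronskianThree {K : Type*} [Field K] (a b c : K[X]) : K[X] :=
  a * (derivative b * derivative (derivative c) - derivative (derivative b) * derivative c) -
  b * (derivative a * derivative (derivative c) - derivative (derivative a) * derivative c) +
  c * (derivative a * derivative (derivative b) - derivative (derivative a) * derivative b)

section

variable {K : Type*} [Field K]

theorem exists_pow_factor (v : K[X]) (k : ℕ) : ∃ b c : K[X],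
    v ^ (k + 2) = v ^ k * v ^ 2 ∧ derivative (v ^ (k + 2)) = v ^ k * b ∧
      derivative (derivative (v ^ (k + 2))) = v ^ k * c := by
  refine ⟨(k + 2) * v * derivative v, (k + 2) * ((k + 1) * derivative v ^ 2 +
    v * derivative (derivative v)), pow_add _ _ _, ?_, ?_⟩
  · simp only [derivative_pow, map_natCast]
    push_cast
    ring
  · rw [derivative_pow, show k + 2 - 1 = k + 1 from rfl, derivative_mul, derivative_mul,
      derivative_pow, Nat.add_sub_cancel]
    simp [map_ofNat C 2]
    ring

/-- Each column holds a power and its first two derivatives, and two derivatives cost at most two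
factors of the base. -/
theorem pow_mul_pow_mul_pow_dvd_wronskianThree (u v w : K[X]) (i j k : ℕ) :
    u ^ i * v ^ j * w ^ k ∣ wronskianThree (u ^ (i + 2)) (v ^ (j + 2)) (w ^ (k + 2)) := by
  obtain ⟨b, c, h1, h2, h3⟩ := exists_pow_factor u i
  obtain ⟨b', c', h1', h2', h3'⟩ := exists_pow_factor v j
  obtain ⟨b'', c'', h1'', h2'', h3''⟩ := exists_pow_factor w k
  rw [wronskianThree, h3, h3', h3'', h2, h2', h2'', h1, h1', h1'']
  exact ⟨u ^ 2 * (b' * c'' - c' * b'') - v ^ 2 * (b * c'' - c * b'') +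
    w ^ 2 * (b * c' - c * b'), by ring⟩

/-- Column operations: the third entry clears `C s * g` from the first, and then `f` clears itself
from the second. -/
theorem wronskianThree_add_C_mul (f g h : K[X]) (s t : K) :
    wronskianThree (f + C s * g) (f + C t * h) g = C t * wronskianThree f h g := by
  simp only [wronskianThree, derivative_add, derivative_C_mul]
  ring

theorem wronskianThree_add_C_mul' (f g h : K[X]) (s t : K) :
    wronskianThree (f + C s * g) (f + C t * h) h = C s * wronskianThree g f h := by
  simp only [wronskianThree, derivative_add, derivative_C_mul]
  ring

/-- A cyclic permutation of the columns, hence no sign. -/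
theorem wronskianThree_swap (f g h : K[X]) :
    wronskianThree g f h = wronskianThree f h g := by
  simp only [wronskianThree]
  ring

/-- A second order operator annihilating `(X - a) ^ m` and `(X - b) ^ m`. -/
noncomputable def pencilOperator (m : ℕ) (a b : K) (f : K[X]) : K[X] :=
  (X - C a) * (X - C b) * derivative (derivative f) -
    C ((m : K) - 1) * (X - C a + (X - C b)) * derivative f + C ((m : K) * (m - 1)) * f

/-- With the two powers fixed, the determinant is a second order operator in `f` that kills both of
them, so it is a multiple of `pencilOperator`. -/
theorem wronskianThree_X_sub_C_pow (f : K[X]) (a b : K) (k : ℕ) :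
    wronskianThree f ((X - C b) ^ (k + 2)) ((X - C a) ^ (k + 2)) =
      C ((k + 2 : K) * (a - b)) * (X - C a) ^ k * (X - C b) ^ k *
        pencilOperator (k + 2) a b f := by
  have hd : ∀ c : K, derivative ((X - C c) ^ (k + 2)) = C (k + 2 : K) * (X - C c) ^ k * (X - C c) ∧
      derivative (derivative ((X - C c) ^ (k + 2))) =
        C ((k + 2 : K) * (k + 1)) * (X - C c) ^ k := by
    intro c
    constructor
    · simp [derivative_pow]; ring
    · simp [derivative_pow]; ring
  rw [wronskianThree, (hd a).2, (hd b).2, (hd a).1, (hd b).1, pencilOperator]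
  simp only [map_mul, map_sub, map_add, C_1, map_natCast, C_ofNat, Nat.cast_add, Nat.cast_ofNat]
  ring

/-- From degree `n` upwards each coefficient of the image depends only on the same coefficient of
`f`, with factor `N(N-1) - 2(m-1)N + m(m-1) = (m-N)(m-N-1)`. -/
theorem coeff_pencilOperator (m : ℕ) (a b : K) (f : K[X]) :
    (pencilOperator m a b f).natDegree ≤ f.natDegree ∧
    (pencilOperator m a b f).coeff f.natDegree =
      ((m : K) - f.natDegree) * (m - f.natDegree - 1) * f.leadingCoeff := by
  set n := f.natDegree with hn
  have h1 : (derivative f).natDegree ≤ n - 1 := natDegree_derivative_le f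
  have h2 : (derivative (derivative f)).natDegree ≤ n - 2 :=
    (natDegree_derivative_le _).trans (by omega)
  have hexp : pencilOperator m a b f = derivative (derivative f) * X ^ 2 -
      C (a + b) * (derivative (derivative f) * X ^ 1) + C (a * b) * derivative (derivative f) -
      C (2 * ((m : K) - 1)) * (derivative f * X ^ 1) +
      C (((m : K) - 1) * (a + b)) * derivative f + C ((m : K) * (m - 1)) * f := by
    simp only [pencilOperator, map_mul, map_add, map_sub, C_ofNat]
    ring
  have hco : ∀ N, n ≤ N → (pencilOperator m a b f).coeff N =
      (N * (N - 1) - 2 * (m - 1) * N + m * (m - 1)) * f.coeff N := by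
    intro N hN
    have hz : f.coeff (N + 1) = 0 := coeff_eq_zero_of_natDegree_lt (by omega)
    have hz2 : f.coeff (N + 2) = 0 := coeff_eq_zero_of_natDegree_lt (by omega)
    rw [hexp]
    simp only [coeff_add, coeff_sub, coeff_C_mul, coeff_mul_X_pow']
    rcases N with _ | _ | N
    · simp [coeff_derivative, hz, hz2]
    · simp [coeff_derivative, hz, hz2]; ring
    · simp [coeff_derivative, hz, hz2]
      ring
  constructor
  · rw [natDegree_le_iff_coeff_eq_zero]
    intro N hN
    rw [hco N hN.le, coeff_eq_zero_of_natDegree_lt hN, mul_zero]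
  · rw [hco n le_rfl, leadingCoeff]
    ring

/-- A degree count for one Wronskian: the forced factors have degree `2(d-2)l + 2(dl-2)`, while its
actual degree is at most `2(dl-2) + deg f`. -/
theorem lt_four_of_pow_sub_pow [CharZero K] {f u v : K[X]} {d l : ℕ} {a b s t : K}
    (hd : 2 ≤ d) (hl : 2 ≤ d * l) (hab : a ≠ b) (hs : s ≠ 0) (ht : t ≠ 0) (hf : f ≠ 0)
    (hn : f.natDegree + 2 ≤ d * l) (hu : u.natDegree = l) (hv : v.natDegree = l)
    (hfu : u ^ d = f + C s * (X - C a) ^ (d * l))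
    (hfv : v ^ d = f + C t * (X - C b) ^ (d * l)) : d < 4 := by
  obtain ⟨e, rfl⟩ := Nat.exists_eq_add_of_le' hd
  obtain ⟨k, hk⟩ := Nat.exists_eq_add_of_le' hl
  rw [hk] at hfu hfv hn
  have hW1 := pow_mul_pow_mul_pow_dvd_wronskianThree u v (X - C a) e e k
  have hW2 := pow_mul_pow_mul_pow_dvd_wronskianThree u v (X - C b) e e k
  rw [hfu, hfv, wronskianThree_add_C_mul] at hW1
  rw [hfu, hfv, wronskianThree_add_C_mul', wronskianThree_swap] at hW2
  rw [(isUnit_C.2 ht.isUnit).dvd_mul_left, wronskianThree_X_sub_C_pow] at hW1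
  rw [(isUnit_C.2 hs.isUnit).dvd_mul_left, wronskianThree_X_sub_C_pow] at hW2
  have hk2 : ((k : K) + 2) * (a - b) ≠ 0 :=
    mul_ne_zero (by exact_mod_cast (by omega : k + 2 ≠ 0)) (sub_ne_zero.2 hab)
  obtain ⟨hG1, hG2⟩ := coeff_pencilOperator (k + 2) a b f
  set G := pencilOperator (k + 2) a b f
  -- The factors `m - n` and `m - n - 1` of the top coefficient do not vanish, by characteristic `0`
  -- and `n + 2 ≤ m`.
  have hG0 : G ≠ 0 := by
    intro h
    rw [h, coeff_zero, eq_comm, mul_eq_zero, mul_eq_zero] at hG2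
    rcases hG2 with (h | h) | h
    · rw [sub_eq_zero] at h
      have : k + 2 = f.natDegree := by exact_mod_cast h
      omega
    · rw [sub_sub, sub_eq_zero] at h
      have : k + 2 = f.natDegree + 1 := by exact_mod_cast h
      omega
    · exact hf (leadingCoeff_eq_zero.1 h)
  have hu0 : u ≠ 0 := by rintro rfl; rw [← hu] at hk; simp at hk
  have hv0 : v ≠ 0 := by rintro rfl; rw [← hv] at hk; simp at hk
  set W := C ((k + 2 : K) * (a - b)) * (X - C a) ^ k * (X - C b) ^ k * G with hW
  have hC : C ((k + 2 : K) * (a - b)) ≠ 0 := C_ne_zero.2 hk2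
  have hA : (X - C a) ^ k ≠ 0 := pow_ne_zero _ (X_sub_C_ne_zero a)
  have hB : (X - C b) ^ k ≠ 0 := pow_ne_zero _ (X_sub_C_ne_zero b)
  have hW0 : W ≠ 0 := mul_ne_zero (mul_ne_zero (mul_ne_zero hC hA) hB) hG0
  have huv : u ^ e * v ^ e ≠ 0 := mul_ne_zero (pow_ne_zero _ hu0) (pow_ne_zero _ hv0)
  -- `u` and `v` need not be coprime to each other or to the linear factors, so `u ^ e * v ^ e` is
  -- cancelled first; only the two linear powers are combined by coprimality.
  obtain ⟨Q, hQ⟩ := (dvd_mul_right _ _).trans hW1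
  have hcop : IsCoprime ((X - C a) ^ k) ((X - C b) ^ k) :=
    (isCoprime_X_sub_C_of_isUnit_sub (sub_ne_zero.2 hab).isUnit).pow
  rw [hQ, mul_dvd_mul_iff_left huv] at hW1 hW2
  have h3 : u ^ e * v ^ e * ((X - C a) ^ k * (X - C b) ^ k) ∣ W := by
    rw [hQ]; exact mul_dvd_mul_left _ (hcop.mul_dvd hW1 hW2)
  have hdeg := natDegree_le_of_dvd h3 hW0
  rw [hW, natDegree_mul huv (mul_ne_zero hA hB), natDegree_mul hA hB,
    natDegree_mul (pow_ne_zero _ hu0) (pow_ne_zero _ hv0),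
    natDegree_mul (mul_ne_zero (mul_ne_zero hC hA) hB) hG0,
    natDegree_mul (mul_ne_zero hC hA) hB, natDegree_mul hC hA, natDegree_C] at hdeg
  simp only [natDegree_pow, natDegree_X_sub_C, hu, hv] at hdeg
  -- If `d = j + 4`, then `2(j+2)l ≤ deg f ≤ (j+4)l - 2`, which is impossible.
  by_contra h
  obtain ⟨j, rfl⟩ := Nat.exists_eq_add_of_le' (by omega : 2 ≤ e)
  nlinarith

end

/-! ### Orders of functions at a point. -/

namespace AlgCurve.Place

variable {K F : Type*} [Field K] [Field F] [Algebra K F] (P : Place K F)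

theorem mem_localRing_iff {h : F} (hh : h ≠ 0) : h ∈ P.localRing ↔ 0 ≤ P.ord h := by
  have := P.isDVR
  have hv : (IsDiscreteValuationRing.maximalIdeal P.localRing).valuation F h ≠ 0 := by simpa
  rw [Place.ord, neg_nonneg, ← WithZero.log_one, WithZero.log_le_log hv one_ne_zero]
  constructor
  · intro hm
    exact (IsDiscreteValuationRing.maximalIdeal P.localRing).valuation_le_one
      (K := F) (⟨h, hm⟩ : P.localRing)
  · intro hle
    obtain ⟨a, rfl⟩ := IsDiscreteValuationRing.exists_lift_of_le_one hle
    exact a.2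

theorem exists_ord_eq_one : ∃ t : F, t ≠ 0 ∧ P.ord t = 1 := by
  have := P.isDVR
  obtain ⟨t, ht⟩ := (IsDiscreteValuationRing.maximalIdeal P.localRing).valuation_exists_uniformizer F
  refine ⟨t, ?_, ?_⟩
  · rintro rfl
    rw [map_zero] at ht
    exact WithZero.exp_ne_zero ht.symm
  · rw [Place.ord, ht]; simp

theorem ord_pow {h : F} (hh : h ≠ 0) (k : ℕ) : P.ord (h ^ k) = k * P.ord h := by
  induction k with
  | zero => simp [ord_one]
  | succ k ih => rw [pow_succ, ord_mul P (pow_ne_zero _ hh) hh, ih]; push_cast; ring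

theorem ord_div {g h : F} (hg : g ≠ 0) (hh : h ≠ 0) : P.ord (g / h) = P.ord g - P.ord h := by
  rw [div_eq_mul_inv, ord_mul P hg (inv_ne_zero hh), ord_inv, sub_eq_add_neg]

theorem ord_zpow {h : F} (hh : h ≠ 0) (k : ℤ) : P.ord (h ^ k) = k * P.ord h := by
  obtain ⟨k, rfl | rfl⟩ := k.eq_nat_or_neg
  · rw [zpow_natCast, ord_pow P hh]
  · rw [zpow_neg, ord_inv, zpow_natCast, ord_pow P hh]; ring

theorem ord_prod {ι : Type*} (s : Finset ι) {g : ι → F} (hg : ∀ i ∈ s, g i ≠ 0) :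
    P.ord (∏ i ∈ s, g i) = ∑ i ∈ s, P.ord (g i) := by
  classical
  induction s using Finset.induction_on with
  | empty => simp [ord_one]
  | insert j s hj ih =>
    have h := fun i hi => hg i (Finset.mem_insert_of_mem hi)
    rw [Finset.prod_insert hj, Finset.sum_insert hj,
      ord_mul P (hg j (Finset.mem_insert_self _ _)) (Finset.prod_ne_zero_iff.2 h), ih h]

theorem ord_algebraMap (c : K) : P.ord (algebraMap K F c) = 0 := by
  rcases eq_or_ne c 0 with rfl | hc
  · simp [ord]
  have h0 : algebraMap K F c ≠ 0 := by simpa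
  have h1 := (P.mem_localRing_iff h0).1 (P.algebraMap_mem c)
  have h2 := (P.mem_localRing_iff (by simpa)).1 (P.algebraMap_mem c⁻¹)
  rw [map_inv₀, ord_inv] at h2
  omega

/-- Dividing by the `k`-th power of a uniformizer reduces the ultrametric inequality to closure of
the local ring under addition. -/
theorem le_ord_add {k : ℤ} {g h : F} (hgh : g + h ≠ 0) (hg : g ≠ 0 → k ≤ P.ord g)
    (hh : h ≠ 0 → k ≤ P.ord h) : k ≤ P.ord (g + h) := by
  obtain ⟨t, ht0, ht⟩ := P.exists_ord_eq_one
  have ht' : t ^ k ≠ 0 := zpow_ne_zero _ ht0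
  have key : ∀ a : F, (a ≠ 0 → k ≤ P.ord a) → a / t ^ k ∈ P.localRing := by
    intro a ha
    rcases eq_or_ne a 0 with rfl | ha0
    · simp [zero_mem]
    · rw [P.mem_localRing_iff (div_ne_zero ha0 ht'), ord_div P ha0 ht', ord_zpow P ht0, ht]
      have := ha ha0
      omega
  have := add_mem (key g hg) (key h hh)
  rw [← add_div, P.mem_localRing_iff (div_ne_zero hgh ht'), ord_div P hgh ht', ord_zpow P ht0,
    ht] at this
  omega

theorem le_ord_sum {ι : Type*} (s : Finset ι) {k : ℤ} {g : ι → F}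
    (hg : ∀ i ∈ s, g i ≠ 0 → k ≤ P.ord (g i)) (h0 : ∑ i ∈ s, g i ≠ 0) :
    k ≤ P.ord (∑ i ∈ s, g i) := by
  classical
  induction s using Finset.induction_on with
  | empty => simp at h0
  | insert j s hj ih =>
    rw [Finset.sum_insert hj] at h0 ⊢
    exact P.le_ord_add h0 (hg j (Finset.mem_insert_self _ _))
      fun h => ih (fun i hi => hg i (Finset.mem_insert_of_mem hi)) h

theorem mem_smul_iff (σ : F ≃ₐ[K] F) (h : F) : h ∈ (σ • P).localRing ↔ σ⁻¹ h ∈ P.localRing :=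
  Iff.rfl

/-- Both sides are nonnegative on the same functions, hence proportional; both take the value `1`,
so the factor is `1`. -/
theorem ord_smul (σ : F ≃ₐ[K] F) (h : F) : (σ • P).ord h = P.ord (σ⁻¹ h) := by
  rcases eq_or_ne h 0 with rfl | hh
  · simp [ord]
  have hmem : ∀ {g : F}, g ≠ 0 → (0 ≤ (σ • P).ord g ↔ 0 ≤ P.ord (σ⁻¹ g)) := by
    intro g hg
    rw [← mem_localRing_iff _ hg, ← mem_localRing_iff _ (by simpa), mem_smul_iff]
  have hzero : ∀ {g : F}, g ≠ 0 → (σ • P).ord g = 0 → P.ord (σ⁻¹ g) = 0 := by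
    intro g hg h0
    have h1 := (hmem hg).1 h0.ge
    have h2 := (hmem (inv_ne_zero hg)).1 (by rw [ord_inv, h0]; simp)
    rw [map_inv₀, ord_inv] at h2
    omega
  obtain ⟨t, ht0, ht⟩ := (σ • P).exists_ord_eq_one
  have hσ : ∀ {g : F}, g ≠ 0 → σ⁻¹ g ≠ 0 := fun hg => by simpa
  have hlin : ∀ {g : F}, g ≠ 0 → P.ord (σ⁻¹ g) = (σ • P).ord g * P.ord (σ⁻¹ t) := by
    intro g hg
    have h1 := hzero (g := g / t ^ (σ • P).ord g) (div_ne_zero hg (zpow_ne_zero _ ht0)) (by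
      rw [ord_div _ hg (zpow_ne_zero _ ht0), ord_zpow _ ht0, ht]; ring)
    rw [map_div₀, map_zpow₀, ord_div _ (hσ hg) (zpow_ne_zero _ (hσ ht0)),
      ord_zpow _ (hσ ht0)] at h1
    omega
  obtain ⟨s, hs0, hs⟩ := P.exists_ord_eq_one
  have h1 := hlin (g := σ s) (by simpa)
  rw [show σ⁻¹ (σ s) = s from σ.symm_apply_apply s, hs] at h1
  have h2 := (hmem ht0).1 (by omega)
  have h3 : P.ord (σ⁻¹ t) = 1 := by
    rcases Int.eq_one_or_neg_one_of_mul_eq_one' h1.symm with h | h <;> omega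
  rw [hlin hh, h3, mul_one]

end AlgCurve.Place

/-! ### Functions regular on the affine curve. -/

namespace CyclicCover

variable {K : Type*} [Field K] (C : CyclicCover K)

theorem algebraMap_eq_aeval (p : K[X]) : algebraMap K[X] C.FunctionField p = aeval C.x p := by
  rw [x, aeval_algebraMap_apply, show AdjoinRoot.of C.equation = algebraMap K[X] C.CoordinateRing
    from rfl, aeval_algebraMap_apply, aeval_X_left_apply, ← IsScalarTower.algebraMap_apply]

theorem aeval_x_injective : Function.Injective (aeval C.x : K[X] →ₐ[K] C.FunctionField) :=
  transcendental_iff_injective.1 C.transcendental_x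

theorem aeval_x_ne_zero {p : K[X]} (hp : p ≠ 0) : aeval C.x p ≠ 0 := by
  rw [Ne, ← map_zero (aeval C.x : K[X] →ₐ[K] C.FunctionField)]
  exact fun h => hp (C.aeval_x_injective h)

variable [IsAlgClosed K]

instance : FaithfulSMul K[X] C.FunctionField :=
  (faithfulSMul_iff_algebraMap_injective _ _).2 fun p q h => by
    rw [algebraMap_eq_aeval, algebraMap_eq_aeval] at h
    exact C.aeval_x_injective h

instance : Module.Finite K[X] C.CoordinateRing := C.monic_equation.finite_adjoinRoot

instance : FaithfulSMul K[X] C.CoordinateRing :=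
  (faithfulSMul_iff_algebraMap_injective _ _).2 fun p q h => by
    apply FaithfulSMul.algebraMap_injective K[X] C.FunctionField
    rw [IsScalarTower.algebraMap_apply K[X] C.CoordinateRing, h,
      ← IsScalarTower.algebraMap_apply]

section

attribute [local instance] FractionRing.liftAlgebra

/-- Characteristic `0` makes the function field a separable extension of `K(x)`. -/
theorem isDedekindDomain_integralClosure [CharZero K] :
    IsDedekindDomain (integralClosure K[X] C.FunctionField) ∧
    IsFractionRing (integralClosure K[X] C.FunctionField) C.FunctionField := by
  have : CharZero (FractionRing K[X]) :=
    charZero_of_injective_algebraMap (IsFractionRing.injective K[X] (FractionRing K[X]))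
  have : FiniteDimensional (FractionRing K[X]) C.FunctionField := inferInstance
  exact ⟨inferInstance, integralClosure.isFractionRing_of_finite_extension (FractionRing K[X]) _⟩

end

/-- A function which is regular at all affine points is integral over `K[x]`. -/
theorem isIntegral_of_forall_mem [CharZero K] {h : C.FunctionField}
    (hh : ∀ P : C.Point, P ≠ C.infinity → h ∈ P.localRing) : IsIntegral K[X] h := by
  obtain ⟨_, _⟩ := C.isDedekindDomain_integralClosure
  suffices h ∈ (algebraMap (integralClosure K[X] C.FunctionField) C.FunctionField).range by
    obtain ⟨a, rfl⟩ := this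
    exact a.2
  -- A Dedekind domain is the intersection of its localizations at height one primes; each of these
  -- contains `x`, so it is an affine point of the curve.
  apply IsDedekindDomain.HeightOneSpectrum.mem_integers_of_valuation_le_one
  intro v
  have hmem : ∀ a : C.FunctionField, IsIntegral K[X] a → v.valuation C.FunctionField a ≤ 1 :=
    fun a ha => v.valuation_le_one (K := C.FunctionField)
      (⟨a, ha⟩ : integralClosure K[X] C.FunctionField)
  have hx : ∀ p : K[X], v.valuation C.FunctionField (aeval C.x p) ≤ 1 := by
    intro p
    rw [← algebraMap_eq_aeval]
    exact hmem _ isIntegral_algebraMap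
  let P : C.Point := ⟨(v.valuation C.FunctionField).valuationSubring, fun c => by
    have := hx (Polynomial.C c)
    rwa [aeval_C] at this, inferInstance⟩
  refine hh P fun hP => ?_
  rw [eq_infinity_iff] at hP
  apply hP
  have := hx X
  rwa [aeval_X] at this

/-- The denominator is integral over `K[X]`, so it divides a nonzero polynomial in `x`; the new
numerator is reduced modulo the equation. -/
theorem exists_mul_eq_sum (h : C.FunctionField) : ∃ (D : K[X]) (p : ℕ → K[X]), D ≠ 0 ∧
    aeval C.x D * h = ∑ i ∈ Finset.range C.d, aeval C.x (p i) * C.y ^ i := by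
  obtain ⟨a, b, hb, rfl⟩ := IsFractionRing.div_surjective C.CoordinateRing h
  obtain ⟨D, hD, b', hb'⟩ := (Algebra.IsIntegral.isIntegral (R := K[X]) b).isAlgebraic.exists_nonzero_dvd hb
  obtain ⟨q, hq⟩ := AdjoinRoot.mk_surjective (a * b')
  refine ⟨D, (q %ₘ C.equation).coeff, hD, ?_⟩
  have hdeg : (q %ₘ C.equation).natDegree < C.d := by
    have h := natDegree_modByMonic_lt q C.monic_equation (by
      intro h
      have := congrArg natDegree h
      rw [equation, natDegree_X_pow_sub_C, natDegree_one] at this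
      exact C.d_ne_zero this)
    rwa [show C.equation.natDegree = C.d from natDegree_X_pow_sub_C] at h
  have hq' : AdjoinRoot.mk C.equation (q %ₘ C.equation) = a * b' := by
    rw [← hq, eq_comm, AdjoinRoot.mk_eq_mk]
    exact ⟨q /ₘ C.equation, by rw [sub_eq_iff_eq_add', modByMonic_add_div]⟩
  have hb0 : algebraMap C.CoordinateRing C.FunctionField b ≠ 0 := by
    simpa using nonZeroDivisors.ne_zero hb
  have h1 : aeval C.x D * (algebraMap C.CoordinateRing C.FunctionField a /
      algebraMap C.CoordinateRing C.FunctionField b) =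
      algebraMap C.CoordinateRing C.FunctionField (a * b') := by
    rw [← algebraMap_eq_aeval, IsScalarTower.algebraMap_apply K[X] C.CoordinateRing, hb',
      map_mul, map_mul]
    field_simp
  rw [h1, ← hq']
  conv_lhs => rw [(q %ₘ C.equation).as_sum_range' _ hdeg]
  simp only [map_sum]
  refine Finset.sum_congr rfl fun i _ => ?_
  rw [← C_mul_X_pow_eq_monomial, map_mul, map_pow, AdjoinRoot.mk_C, AdjoinRoot.mk_X, map_mul,
    map_pow, y, ← algebraMap_eq_aeval]
  rfl

end CyclicCover

/-! ### Decomposition under `μ_d` and pole orders at infinity. -/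

namespace CyclicCover

variable {K : Type*} [Field K] (C : CyclicCover K)

theorem f_ne_zero : C.f ≠ 0 := by
  intro h
  have := C.natDegree_f; have := C.d_lt_n; simp [h] at *; omega

theorem x_ne_zero : C.x ≠ 0 := by
  have := C.aeval_x_ne_zero X_ne_zero
  rwa [aeval_X] at this

theorem y_ne_zero : C.y ≠ 0 := by
  intro h
  have := C.y_pow
  rw [h, zero_pow C.d_ne_zero] at this
  exact C.aeval_x_ne_zero C.f_ne_zero this.symm

theorem d_pos : 0 < C.d := Nat.pos_of_ne_zero C.d_ne_zero

variable [IsAlgClosed K]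

section

attribute [local instance] FractionRing.liftAlgebra

theorem dvd_of_isIntegral_div {p q : K[X]} (hq : q ≠ 0)
    (h : IsIntegral K[X] (aeval C.x p / aeval C.x q)) : q ∣ p := by
  rw [← algebraMap_eq_aeval, ← algebraMap_eq_aeval,
    IsScalarTower.algebraMap_apply K[X] (FractionRing K[X]) C.FunctionField,
    IsScalarTower.algebraMap_apply K[X] (FractionRing K[X]) C.FunctionField, ← map_div₀,
    isIntegral_algebraMap_iff (algebraMap (FractionRing K[X]) C.FunctionField).injective,
    IsIntegrallyClosed.isIntegral_iff] at h
  obtain ⟨r, hr⟩ := h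
  have hq0 : algebraMap K[X] (FractionRing K[X]) q ≠ 0 := by simpa
  rw [eq_div_iff hq0, ← map_mul] at hr
  exact ⟨r, by rw [← IsFractionRing.injective K[X] (FractionRing K[X]) hr, mul_comm]⟩

end

/-- The `d`-th power lies in `K(x)`, so `D ^ d ∣ p ^ d * f ^ i`. Roots of `f` are simple and `i <
d`, so `f ^ i` cannot supply a missing `d`-fold root. -/
theorem dvd_of_isIntegral_mul_y_pow_div {p D : K[X]} (hD : D ≠ 0) {i : ℕ} (hi : i < C.d)
    (h : IsIntegral K[X] (aeval C.x p * C.y ^ i / aeval C.x D)) : D ∣ p := by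
  classical
  rcases eq_or_ne p 0 with rfl | hp
  · exact dvd_zero _
  have h1 : (aeval C.x p * C.y ^ i / aeval C.x D) ^ C.d =
      aeval C.x (p ^ C.d * C.f ^ i) / aeval C.x (D ^ C.d) := by
    rw [div_pow, mul_pow, ← pow_mul, mul_comm i, pow_mul, y_pow]
    simp only [map_mul, map_pow]
  have h2 := h.pow C.d
  rw [h1] at h2
  have h3 := C.dvd_of_isIntegral_div (pow_ne_zero _ hD) h2
  rw [IsAlgClosed.dvd_iff_roots_le_roots (pow_ne_zero _ hD)
    (mul_ne_zero (pow_ne_zero _ hp) (pow_ne_zero _ C.f_ne_zero)), roots_mul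
    (mul_ne_zero (pow_ne_zero _ hp) (pow_ne_zero _ C.f_ne_zero)), roots_pow, roots_pow,
    roots_pow, Multiset.le_iff_count] at h3
  rw [IsAlgClosed.dvd_iff_roots_le_roots hD hp, Multiset.le_iff_count]
  intro a
  have h4 := h3 a
  rw [Multiset.count_add, Multiset.count_nsmul, Multiset.count_nsmul, Multiset.count_nsmul] at h4
  have h5 := Multiset.nodup_iff_count_le_one.1 C.nodup_roots a
  by_contra! hlt
  have h6 := Nat.mul_le_mul_left C.d (Nat.succ_le_of_lt hlt)
  have h7 := Nat.mul_le_mul_left i h5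
  rw [Nat.succ_eq_add_one, mul_add] at h6
  omega

theorem muHom_aeval_x (ζ : rootsOfUnity C.d K) (p : K[X]) :
    C.muHom ζ (aeval C.x p) = aeval C.x p := by
  rw [← aeval_algHom_apply, muHom_x]

theorem muHom_y' (ζ : rootsOfUnity C.d K) :
    C.muHom ζ C.y = algebraMap K _ (((ζ⁻¹ : rootsOfUnity C.d K) : Kˣ) : K) * C.y := by
  rw [muHom_y, Units.smul_def, Algebra.smul_def]

theorem ord_smul (ζ : rootsOfUnity C.d K) (P : C.Point) (h : C.FunctionField) :
    (ζ • P).ord h = P.ord (C.muHom ζ⁻¹ h) := by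
  rw [map_inv]
  exact Place.ord_smul P (C.muHom ζ) h

theorem smul_infinity (ζ : rootsOfUnity C.d K) : ζ • C.infinity = C.infinity := by
  rw [eq_infinity_iff]
  have h := (C.eq_infinity_iff C.infinity).1 rfl
  rw [← C.muHom_x ζ⁻¹, map_inv] at h
  exact h

theorem ord_infinity_muHom (ζ : rootsOfUnity C.d K) (h : C.FunctionField) :
    C.infinity.ord (C.muHom ζ h) = C.infinity.ord h := by
  conv_rhs => rw [← C.smul_infinity ζ⁻¹]
  rw [ord_smul, inv_inv]

theorem exists_isPrimitiveRoot : ∃ ζ : K, IsPrimitiveRoot ζ C.d := by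
  have : NeZero (C.d : K) := ⟨C.d_cast_ne_zero⟩
  exact HasEnoughRootsOfUnity.exists_primitiveRoot K C.d

/-- Orthogonality of the characters of `μ_d`. -/
theorem sum_rootsOfUnity {i j : ℕ} (hi : i < C.d) (hj : j < C.d) [Fintype (rootsOfUnity C.d K)] :
    ∑ ζ : rootsOfUnity C.d K, ((ζ : Kˣ) : K) ^ j * (((ζ⁻¹ : rootsOfUnity C.d K) : Kˣ) : K) ^ i =
      if i = j then (C.d : K) else 0 := by
  have : NeZero C.d := ⟨C.d_ne_zero⟩
  obtain ⟨ω, hω⟩ := C.exists_isPrimitiveRoot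
  split_ifs with hij
  · subst hij
    have hc : Fintype.card (rootsOfUnity C.d K) = C.d := by
      rw [← Nat.card_eq_fintype_card]; exact hω.card_rootsOfUnity
    rw [Finset.sum_congr rfl (g := fun _ => (1 : K)), Finset.sum_const, Finset.card_univ, hc]
    · simp
    · intro ζ _
      rw [← mul_pow]; simp
  · let φ : rootsOfUnity C.d K →* K :=
      { toFun := fun ζ => ((ζ : Kˣ) : K) ^ j * (((ζ⁻¹ : rootsOfUnity C.d K) : Kˣ) : K) ^ i
        map_one' := by simp
        map_mul' := fun a b => by simp; ring }
    refine sum_hom_units_eq_zero φ fun h => hij ?_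
    have h1 := DFunLike.congr_fun h hω.toRootsOfUnity
    simp only [φ, MonoidHom.coe_mk, OneHom.coe_mk, MonoidHom.one_apply] at h1
    have h2 : (((hω.toRootsOfUnity⁻¹ : rootsOfUnity C.d K) : Kˣ) : K) = ω⁻¹ := by simp
    have h3 : ((hω.toRootsOfUnity : Kˣ) : K) = ω := by simp
    rw [h2, h3, inv_pow, mul_inv_eq_one₀ (pow_ne_zero _ (hω.ne_zero C.d_ne_zero))] at h1
    exact (hω.pow_inj hj hi h1).symm

/-- The right side is the projection onto the eigenspace of `μ_d` spanned by `y ^ j` over `K(x)`. It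
lets each component inherit properties of `h` that are stable under conjugation. -/
theorem sum_muHom [Fintype (rootsOfUnity C.d K)] {h : C.FunctionField} {D : K[X]} {p : ℕ → K[X]}
    (hD : D ≠ 0) (hp : aeval C.x D * h = ∑ i ∈ Finset.range C.d, aeval C.x (p i) * C.y ^ i)
    {j : ℕ} (hj : j < C.d) :
    aeval C.x (p j) * C.y ^ j / aeval C.x D = ∑ ζ : rootsOfUnity C.d K,
      algebraMap K C.FunctionField (((ζ : Kˣ) : K) ^ j / C.d) * C.muHom ζ h := by
  have hD0 := C.aeval_x_ne_zero hD
  have h1 : ∀ ζ : rootsOfUnity C.d K, C.muHom ζ h = (∑ i ∈ Finset.range C.d,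
      aeval C.x (p i) * (algebraMap K _ (((ζ⁻¹ : rootsOfUnity C.d K) : Kˣ) : K) * C.y) ^ i) /
        aeval C.x D := by
    intro ζ
    rw [eq_div_iff hD0, mul_comm]
    have := congrArg (C.muHom ζ) hp
    rw [map_mul, muHom_aeval_x, map_sum] at this
    rw [this]
    refine Finset.sum_congr rfl fun i _ => ?_
    rw [map_mul, map_pow, muHom_aeval_x, muHom_y']
  rw [div_eq_iff hD0, Finset.sum_mul]
  have h2 : ∀ ζ : rootsOfUnity C.d K, algebraMap K C.FunctionField (((ζ : Kˣ) : K) ^ j / C.d) *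
      C.muHom ζ h * aeval C.x D = ∑ i ∈ Finset.range C.d, aeval C.x (p i) * C.y ^ i *
        algebraMap K C.FunctionField (((ζ : Kˣ) : K) ^ j *
          (((ζ⁻¹ : rootsOfUnity C.d K) : Kˣ) : K) ^ i / C.d) := by
    intro ζ
    rw [h1 ζ, mul_assoc, div_mul_cancel₀ _ hD0, Finset.mul_sum]
    refine Finset.sum_congr rfl fun i _ => ?_
    simp only [map_div₀, map_mul, map_pow, mul_pow]
    ring
  rw [Finset.sum_congr rfl fun ζ _ => h2 ζ, Finset.sum_comm]
  have h3 : ∀ i ∈ Finset.range C.d, ∑ ζ : rootsOfUnity C.d K, aeval C.x (p i) * C.y ^ i *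
        algebraMap K C.FunctionField (((ζ : Kˣ) : K) ^ j *
          (((ζ⁻¹ : rootsOfUnity C.d K) : Kˣ) : K) ^ i / C.d) =
      if i = j then aeval C.x (p i) * C.y ^ i else 0 := by
    intro i hi
    rw [← Finset.mul_sum, ← map_sum, ← Finset.sum_div,
      C.sum_rootsOfUnity (Finset.mem_range.1 hi) hj]
    split_ifs
    · rw [div_self C.d_cast_ne_zero, map_one, mul_one]
    · simp
  rw [Finset.sum_congr rfl h3, Finset.sum_ite_eq', if_pos (Finset.mem_range.2 hj)]

/-- A function without affine poles is a polynomial in `x` and `y`, and the pole orders of its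
homogeneous components at infinity are bounded by its own. -/
theorem exists_eq_sum_of_isIntegral {h : C.FunctionField} (hh : IsIntegral K[X] h) :
    ∃ p : ℕ → K[X], h = ∑ i ∈ Finset.range C.d, aeval C.x (p i) * C.y ^ i ∧
      ∀ i < C.d, p i ≠ 0 → C.infinity.ord h ≤ C.infinity.ord (aeval C.x (p i) * C.y ^ i) := by
  have : NeZero C.d := ⟨C.d_ne_zero⟩
  have : Fintype (rootsOfUnity C.d K) := Fintype.ofFinite _
  obtain ⟨D, p, hD, hp⟩ := C.exists_mul_eq_sum h
  have hD0 := C.aeval_x_ne_zero hD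
  -- The bound on `i` sits inside the existential so that `choose` yields a total function.
  have hdvd : ∀ i, ∃ q : K[X], i < C.d → p i = D * q := by
    intro i
    by_cases hi : i < C.d
    · have : D ∣ p i := by
        refine C.dvd_of_isIntegral_mul_y_pow_div hD hi ?_
        rw [C.sum_muHom hD hp hi]
        refine IsIntegral.sum _ fun ζ _ => IsIntegral.mul ?_ ?_
        · rw [IsScalarTower.algebraMap_apply K K[X] C.FunctionField]
          exact isIntegral_algebraMap
        · obtain ⟨P, hP, hP'⟩ := hh
          refine ⟨P, hP, ?_⟩
          have h1 : ((C.muHom ζ : C.FunctionField →+* C.FunctionField)).comp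
              (algebraMap K[X] C.FunctionField) = algebraMap K[X] C.FunctionField := by
            exact RingHom.ext fun q => by simp [algebraMap_eq_aeval, muHom_aeval_x]
          have h2 := congrArg (C.muHom ζ : C.FunctionField →+* C.FunctionField) hP'
          rw [hom_eval₂, h1, map_zero] at h2
          exact h2
      obtain ⟨q, hq⟩ := this
      exact ⟨q, fun _ => hq⟩
    · exact ⟨0, fun h => absurd h hi⟩
  choose q hq using hdvd
  refine ⟨q, ?_, ?_⟩
  · rw [← mul_right_inj' hD0, hp, Finset.mul_sum]
    refine Finset.sum_congr rfl fun i hi => ?_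
    rw [hq i (Finset.mem_range.1 hi), map_mul, mul_assoc]
  · intro i hi hqi
    have h1 : aeval C.x (q i) * C.y ^ i = aeval C.x (p i) * C.y ^ i / aeval C.x D := by
      rw [hq i hi, map_mul]
      field_simp
    have h0 : aeval C.x (q i) * C.y ^ i ≠ 0 :=
      mul_ne_zero (C.aeval_x_ne_zero hqi) (pow_ne_zero _ C.y_ne_zero)
    rw [h1] at h0 ⊢
    rw [C.sum_muHom hD hp hi] at h0 ⊢
    -- `μ_d` fixes the point at infinity, so all conjugates of `h` have the same order there.
    refine Place.le_ord_sum _ _ (fun ζ _ h0 => ?_) h0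
    rw [Place.ord_mul _ (left_ne_zero_of_mul h0) (right_ne_zero_of_mul h0), Place.ord_algebraMap,
      ord_infinity_muHom, zero_add]

/-- `x` and `y` have poles of orders proportional to `d` and `n` at infinity. -/
theorem exists_ord_infinity : ∃ e : ℤ, 1 ≤ e ∧ C.infinity.ord C.y = -(C.n * e) ∧
    ∀ p : K[X], p ≠ 0 → C.infinity.ord (aeval C.x p) = -(C.d * p.natDegree * e) := by
  have hO := (C.eq_infinity_iff C.infinity).1 rfl
  have hpole : C.IsPole C.infinity.localRing := ⟨C.infinity.algebraMap_mem, hO⟩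
  have hval : ∀ {g h : C.FunctionField}, g ≠ 0 → h ≠ 0 →
      C.infinity.localRing.valuation g = C.infinity.localRing.valuation h →
      C.infinity.ord g = C.infinity.ord h := by
    intro g h hg hh hgh
    have key : ∀ {a b : C.FunctionField}, a ≠ 0 → b ≠ 0 →
        C.infinity.localRing.valuation a = C.infinity.localRing.valuation b →
        C.infinity.ord b ≤ C.infinity.ord a := by
      intro a b ha hb hab
      have : a / b ∈ C.infinity.localRing := by
        rw [← ValuationSubring.valuation_le_one_iff, map_div₀, hab, div_self (by simpa)]
      rw [Place.mem_localRing_iff _ (div_ne_zero ha hb), Place.ord_div _ ha hb] at this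
      omega
    exact le_antisymm (key hh hg hgh.symm) (key hg hh hgh)
  have hp : ∀ p : K[X], p ≠ 0 →
      C.infinity.ord (aeval C.x p) = p.natDegree * C.infinity.ord C.x := by
    intro p hp
    rw [← Place.ord_pow _ C.x_ne_zero]
    refine hval (C.aeval_x_ne_zero hp) (pow_ne_zero _ C.x_ne_zero) ?_
    rw [hpole.valuation_aeval hp, map_pow]
  have hx : C.infinity.ord C.x < 0 := by
    rw [Place.mem_localRing_iff _ C.x_ne_zero] at hO
    omega
  have hy : C.d * C.infinity.ord C.y = C.n * C.infinity.ord C.x := by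
    rw [← Place.ord_pow _ C.y_ne_zero, y_pow, hp _ C.f_ne_zero, natDegree_f]
  -- From `d * ord y = n * ord x`, coprimality gives `d ∣ ord x`; `e` is minus the quotient.
  -- Positivity suffices for now.
  have hcop : IsCoprime (C.d : ℤ) C.n := (Nat.isCoprime_iff_coprime.2 C.coprime).symm
  obtain ⟨k, hk⟩ := hcop.dvd_of_dvd_mul_left (Dvd.intro _ hy)
  have hd : (0 : ℤ) < C.d := by exact_mod_cast C.d_pos
  refine ⟨-k, ?_, ?_, fun p h0 => ?_⟩
  · rw [hk] at hx
    by_contra hlt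
    nlinarith
  · rw [hk] at hy
    have : (C.d : ℤ) * C.infinity.ord C.y = C.d * (C.n * k) := by rw [hy]; ring
    rw [mul_right_inj' hd.ne'] at this
    rw [this]; ring
  · rw [hp p h0, hk]; ring

end CyclicCover

/-! ### From packets to polynomial identities. -/

namespace CyclicCover

variable {K : Type*} [Field K] (C : CyclicCover K)

theorem m₀_eq : C.m₀ = C.d * C.l₀ := mul_comm _ _

theorem n_lt_m₀ : C.n < C.m₀ := by
  have h := Nat.div_add_mod C.n C.d
  have h1 := Nat.mod_lt C.n C.d_pos
  rw [m₀_eq, l₀, Nat.add_div_right _ C.d_pos, mul_add]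
  omega

theorem m₀_lt : C.m₀ < C.n + C.d := by
  have h := Nat.div_add_mod C.n C.d
  have h1 : C.n % C.d ≠ 0 := fun h => by
    have h2 := C.coprime.symm.eq_one_of_dvd (Nat.dvd_of_mod_eq_zero h)
    have := C.two_le_d
    omega
  rw [m₀_eq, l₀, Nat.add_div_right _ C.d_pos, mul_add]
  omega

variable [IsAlgClosed K]

theorem x_mem {P : C.Point} (hP : P ≠ C.infinity) (p : K[X]) : aeval C.x p ∈ P.localRing := by
  have hx : C.x ∈ P.localRing := by
    by_contra h
    exact hP ((C.eq_infinity_iff P).2 h)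
  induction p using Polynomial.induction_on' with
  | add p q hp hq => rw [map_add]; exact add_mem hp hq
  | monomial k c =>
    rw [aeval_monomial]
    exact mul_mem (P.algebraMap_mem c) (pow_mem hx k)

theorem ord_aeval_infinity_nonpos (p : K[X]) : C.infinity.ord (aeval C.x p) ≤ 0 := by
  obtain ⟨e, he, -, h⟩ := C.exists_ord_infinity
  rcases eq_or_ne p 0 with rfl | hp
  · simp [Place.ord]
  · rw [h p hp]
    have : (0 : ℤ) ≤ C.d * p.natDegree * e := by positivity
    omega

theorem ord_pos_of_dvd {Q : C.Point} {p q : K[X]} (hpq : p ∣ q) (hq : q ≠ 0)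
    (h : 0 < Q.ord (aeval C.x p)) : 0 < Q.ord (aeval C.x q) := by
  obtain ⟨r, rfl⟩ := hpq
  have hQ : Q ≠ C.infinity := by
    rintro rfl
    exact absurd h (C.ord_aeval_infinity_nonpos p).not_gt
  have hr := C.aeval_x_ne_zero (right_ne_zero_of_mul hq)
  have := (Q.mem_localRing_iff hr).1 (C.x_mem hQ r)
  rw [map_mul, Place.ord_mul _ (C.aeval_x_ne_zero (left_ne_zero_of_mul hq)) hr]
  omega

/-- Otherwise `1 / (x - a)` would be regular at every affine point, hence integral over `K[x]`. -/
theorem exists_ord_pos [CharZero K] (a : K) :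
    ∃ Q : C.Point, 0 < Q.ord (aeval C.x (X - Polynomial.C a)) := by
  by_contra! hQ
  have ha := C.aeval_x_ne_zero (X_sub_C_ne_zero a)
  have h1 : IsIntegral K[X] (aeval C.x (1 : K[X]) / aeval C.x (X - Polynomial.C a)) := by
    refine C.isIntegral_of_forall_mem fun P _ => ?_
    rw [map_one, one_div, Place.mem_localRing_iff _ (inv_ne_zero ha), Place.ord_inv]
    have := hQ P
    omega
  exact not_isUnit_X_sub_C a (isUnit_of_dvd_one (C.dvd_of_isIntegral_div (X_sub_C_ne_zero a) h1))

theorem eq_of_ord_pos {P : C.Point} {a b : K} (ha : 0 < P.ord (aeval C.x (X - Polynomial.C a)))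
    (hb : 0 < P.ord (aeval C.x (X - Polynomial.C b))) : a = b := by
  by_contra hab
  have h1 : aeval C.x (X - Polynomial.C a) + -1 * aeval C.x (X - Polynomial.C b) =
      algebraMap K C.FunctionField (b - a) := by
    simp
  have h0 : algebraMap K C.FunctionField (b - a) ≠ 0 := by
    simpa [sub_eq_zero] using Ne.symm hab
  have h2 : 1 ≤ P.ord (aeval C.x (X - Polynomial.C a) +
      -1 * aeval C.x (X - Polynomial.C b)) := by
    refine P.le_ord_add (by rwa [h1]) (fun _ => ha) fun _ => ?_
    rw [Place.ord_mul P (by simp) (C.aeval_x_ne_zero (X_sub_C_ne_zero b))]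
    have := P.ord_algebraMap (F := C.FunctionField) (-1)
    rw [map_neg, map_one] at this
    omega
  rw [h1, Place.ord_algebraMap] at h2
  omega

theorem ord_smul_aeval (ζ : rootsOfUnity C.d K) (P : C.Point) (p : K[X]) :
    (ζ • P).ord (aeval C.x p) = P.ord (aeval C.x p) := by
  rw [ord_smul, muHom_aeval_x]

theorem exists_of_order_eq {P : C.Point} (hP : P ≠ C.infinity) {m : ℕ} (h : C.order P = m) :
    ∃ h : C.FunctionField, h ≠ 0 ∧ P.ord h = m ∧ C.infinity.ord h = -m ∧
      ∀ Q : C.Point, Q ≠ P → Q ≠ C.infinity → Q.ord h = 0 := by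
  classical
  have h1 := addOrderOf_nsmul_eq_zero (toJacobian C.infinity P)
  rw [show addOrderOf (toJacobian C.infinity P) = m from h, toJacobian, ← QuotientAddGroup.mk_nsmul,
    QuotientAddGroup.eq_zero_iff, AddSubgroup.mem_addSubgroupOf] at h1
  obtain ⟨g, hg, hdiv⟩ := h1
  have hdiv' : ∀ Q : C.Point, Q.ord g = m * ((if P = Q then 1 else 0) -
      if C.infinity = Q then 1 else 0) := by
    intro Q
    rw [← hdiv Q]
    simp [Finsupp.single_apply]
  refine ⟨g, hg, ?_, ?_, fun Q hQ hQ' => ?_⟩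
  · rw [hdiv', if_pos rfl, if_neg hP.symm]; ring
  · rw [hdiv', if_pos rfl, if_neg hP]; ring
  · rw [hdiv', if_neg hQ.symm, if_neg hQ'.symm]; ring

/-- A function with only pole of order `m₀` at infinity, not fixed by `μ_d`, has the form
`c (y - v(x))`. -/
theorem exists_eq_mul_y_sub [CharZero K] {h : C.FunctionField} (hh : IsIntegral K[X] h)
    (hO : C.infinity.ord h = -C.m₀) (hinv : ∃ ζ, C.muHom ζ h ≠ h) :
    ∃ (c : K) (v : K[X]), c ≠ 0 ∧ v.natDegree = C.l₀ ∧
      h = algebraMap K C.FunctionField c * (C.y - aeval C.x v) := by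
  obtain ⟨p, hp, hbound⟩ := C.exists_eq_sum_of_isIntegral hh
  obtain ⟨e, he, hy, hx⟩ := C.exists_ord_infinity
  have hnm := C.n_lt_m₀
  have hmn := C.m₀_lt
  have hdn := C.d_lt_n
  have hd2 := C.two_le_d
  have hle : ∀ i < C.d, p i ≠ 0 → (C.d * (p i).natDegree + C.n * i) * e ≤ (C.m₀ : ℤ) := by
    intro i hi h0
    have h1 := hbound i hi h0
    rw [hO, Place.ord_mul _ (C.aeval_x_ne_zero h0) (pow_ne_zero _ C.y_ne_zero),
      Place.ord_pow _ C.y_ne_zero, hy, hx _ h0] at h1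
    linarith
  have hle' : ∀ i < C.d, p i ≠ 0 → C.d * (p i).natDegree + C.n * i ≤ C.m₀ := by
    intro i hi h0
    have h1 := hle i hi h0
    have h2 : (0 : ℤ) ≤ C.d * (p i).natDegree + C.n * i := by positivity
    zify
    nlinarith
  -- The pole of `y ^ i` is too large: `m₀ < n + d < 2n`.
  have hhigh : ∀ i < C.d, 2 ≤ i → p i = 0 := by
    intro i hi h2
    by_contra h0
    have h1 := hle' i hi h0
    have := Nat.mul_le_mul_left C.n h2
    omega
  have hsum : h = aeval C.x (p 0) + aeval C.x (p 1) * C.y := by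
    obtain ⟨k, hk⟩ := Nat.exists_eq_add_of_le' hd2
    rw [hp, hk, Finset.sum_range_succ', Finset.sum_range_succ', Finset.sum_eq_zero]
    · simp [add_comm]
    · intro i hi
      rw [Finset.mem_range] at hi
      rw [hhigh _ (by omega) (by omega), map_zero, zero_mul]
  have hp1 : p 1 ≠ 0 := by
    intro h0
    obtain ⟨ζ, hζ⟩ := hinv
    rw [hsum, h0, map_zero, zero_mul, add_zero, muHom_aeval_x] at hζ
    exact hζ rfl
  have hdeg1 : (p 1).natDegree = 0 := by
    have h1 := hle' 1 (by omega) hp1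
    by_contra h0
    have := Nat.mul_le_mul_left C.d (Nat.one_le_iff_ne_zero.2 h0)
    omega
  -- The `y` term survives, so `n * e ≤ m₀ < 2n`.
  have he1 : e = 1 := by
    have h1 := hle 1 (by omega) hp1
    rw [hdeg1] at h1
    by_contra hne
    have : 2 ≤ e := by omega
    push_cast at h1
    nlinarith
  subst he1
  obtain ⟨c, hc⟩ := natDegree_eq_zero.1 hdeg1
  have hc0 : c ≠ 0 := by
    rintro rfl
    rw [map_zero] at hc
    exact hp1 hc.symm
  have hcF : algebraMap K C.FunctionField c ≠ 0 := by simpa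
  have hcy : C.infinity.ord (algebraMap K C.FunctionField c * C.y) = -C.n := by
    rw [Place.ord_mul _ hcF C.y_ne_zero, Place.ord_algebraMap, hy]
    ring
  rw [← hc, aeval_C] at hsum
  have hdeg0 : (p 0).natDegree = C.l₀ := by
    apply Nat.eq_of_mul_eq_mul_left C.d_pos
    rw [← m₀_eq]
    refine le_antisymm ?_ ?_
    · rcases eq_or_ne (p 0) 0 with h0 | h0
      · simp [h0]
      · simpa using hle' 0 (by omega) h0
    -- With a smaller degree both summands would have poles of order below `m₀`, since `n < m₀`.
    · by_contra! hlt
      have hh0 : h ≠ 0 := by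
        rintro rfl
        obtain ⟨ζ, hζ⟩ := hinv
        simp at hζ
      rw [hsum] at hO hh0
      have h1 := C.infinity.le_ord_add (k := -C.m₀ + 1) hh0 (fun _ => ?_) (fun _ => ?_)
      · omega
      · rcases eq_or_ne (p 0) 0 with h0 | h0
        · rw [h0, map_zero, zero_add, hcy] at hO
          omega
        · rw [hx _ h0]
          zify at hlt
          linarith
      · rw [hcy]
        omega
  refine ⟨c, Polynomial.C (-c⁻¹) * p 0, hc0, ?_, ?_⟩
  · rw [natDegree_C_mul (neg_ne_zero.2 (inv_ne_zero hc0)), hdeg0]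
  · rw [hsum, map_mul, aeval_C, map_neg, map_inv₀]
    field_simp
    ring

/-- The norm factors as `v ^ d - y ^ d = ∏ (v - η y)` over the `d`-th roots of unity, and each
factor is a constant times a conjugate of `c (y - v)`. -/
theorem exists_ord_muHom_pos {c : K} {v : K[X]} (hc : c ≠ 0) {Q : C.Point}
    (hne : v ^ C.d - C.f ≠ 0) (h : 0 < Q.ord (aeval C.x (v ^ C.d - C.f))) :
    ∃ ζ, 0 < Q.ord (C.muHom ζ (algebraMap K C.FunctionField c * (C.y - aeval C.x v))) := by
  have : NeZero C.d := ⟨C.d_ne_zero⟩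
  obtain ⟨ω, hω⟩ := C.exists_isPrimitiveRoot
  have hωF := hω.map_of_injective (algebraMap K C.FunctionField).injective
  have hprod := hωF.pow_sub_pow_eq_prod_sub_mul (aeval C.x v) C.y C.d_pos
  have hval : aeval C.x (v ^ C.d - C.f) = aeval C.x v ^ C.d - C.y ^ C.d := by
    rw [map_sub, map_pow, y_pow]
  rw [← hval] at hprod
  have h0 := C.aeval_x_ne_zero hne
  rw [hprod] at h h0
  rw [Place.ord_prod _ _ (Finset.prod_ne_zero_iff.1 h0)] at h
  obtain ⟨η, hη, hpos⟩ := Finset.exists_lt_of_sum_lt (f := fun _ => (0 : ℤ)) (by simpa using h)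
  obtain ⟨k, -, hk⟩ := hωF.eq_pow_of_pow_eq_one ((mem_nthRootsFinset C.d_pos _).1 hη)
  refine ⟨hω.toRootsOfUnity⁻¹ ^ k, ?_⟩
  have h1 : C.muHom (hω.toRootsOfUnity⁻¹ ^ k) (algebraMap K C.FunctionField c *
      (C.y - aeval C.x v)) = algebraMap K C.FunctionField (-c) * (aeval C.x v - η * C.y) := by
    rw [map_mul, map_sub, muHom_y', muHom_aeval_x, AlgEquiv.commutes, ← hk]
    simp
    ring
  rw [h1, Place.ord_mul _ (by simpa) (Finset.prod_ne_zero_iff.1 h0 η hη), Place.ord_algebraMap,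
    zero_add]
  exact hpos

theorem eq_C_mul_X_sub_C_pow {N : K[X]} (hN : 0 < N.natDegree)
    (h : ∀ a b, N.IsRoot a → N.IsRoot b → a = b) :
    ∃ a s : K, s ≠ 0 ∧ N = Polynomial.C s * (X - Polynomial.C a) ^ N.natDegree := by
  have hN0 : N ≠ 0 := by rintro rfl; simp at hN
  obtain ⟨a, ha⟩ := IsAlgClosed.exists_root N (natDegree_pos_iff_degree_pos.1 hN).ne'
  refine ⟨a, N.leadingCoeff, leadingCoeff_ne_zero.2 hN0, ?_⟩
  have hs := IsAlgClosed.splits N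
  have hr : N.roots = Multiset.replicate N.natDegree a := by
    rw [hs.natDegree_eq_card_roots]
    exact Multiset.eq_replicate_card.2 fun b hb => h b a (isRoot_of_mem_roots hb) ha
  conv_lhs => rw [hs.eq_prod_roots, hr, Multiset.map_replicate, Multiset.prod_replicate]

/-- `P` is the only zero of `h = c (y - v)`, so the norm `v ^ d - f` vanishes only below the orbit
of `P`. The last clause, on points above `a`, serves to separate two packets. -/
theorem exists_of_nontrivial_orbit [CharZero K] {P : C.Point}
    (horb : (MulAction.orbit (rootsOfUnity C.d K) P).Nontrivial) (hord : C.order P = C.m₀) :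
    ∃ (v : K[X]) (a s : K), s ≠ 0 ∧ v.natDegree = C.l₀ ∧
      v ^ C.d = C.f + Polynomial.C s * (X - Polynomial.C a) ^ (C.d * C.l₀) ∧
      ∀ Q : C.Point, 0 < Q.ord (aeval C.x (X - Polynomial.C a)) →
        Q ∈ MulAction.orbit (rootsOfUnity C.d K) P := by
  have hmove : ∃ ζ : rootsOfUnity C.d K, ζ • P ≠ P := by
    by_contra! hfix
    obtain ⟨_, ⟨ζ, rfl⟩, _, ⟨ξ, rfl⟩, hne⟩ := horb
    exact hne ((hfix ζ).trans (hfix ξ).symm)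
  have hP : P ≠ C.infinity := by
    rintro rfl
    obtain ⟨ζ, hζ⟩ := hmove
    exact hζ (C.smul_infinity ζ)
  obtain ⟨h, hh0, hhP, hhO, hhQ⟩ := C.exists_of_order_eq hP hord
  have hm : 0 < C.m₀ := (Nat.zero_le _).trans_lt C.n_lt_m₀
  have hposP : ∀ Q : C.Point, 0 < Q.ord h → Q = P := by
    intro Q hQ
    by_contra hne
    rcases eq_or_ne Q C.infinity with rfl | hQO
    · omega
    · rw [hhQ Q hne hQO] at hQ
      exact lt_irrefl _ hQ
  have hint : IsIntegral K[X] h := by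
    refine C.isIntegral_of_forall_mem fun Q hQ => (Q.mem_localRing_iff hh0).2 ?_
    rcases eq_or_ne Q P with rfl | hne
    · omega
    · rw [hhQ Q hne hQ]
  -- An invariant `h` would vanish on the whole orbit, but its only zero is `P`.
  have hinv : ∃ ζ, C.muHom ζ h ≠ h := by
    obtain ⟨ζ, hζ⟩ := hmove
    refine ⟨ζ⁻¹, fun heq => hζ (hposP _ ?_)⟩
    rw [ord_smul, heq, hhP]
    omega
  obtain ⟨c, v, hc, hv, rfl⟩ := C.exists_eq_mul_y_sub hint hhO hinv
  have hdeg : (v ^ C.d - C.f).natDegree = C.d * C.l₀ := by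
    rw [natDegree_sub_eq_left_of_natDegree_lt, natDegree_pow, hv]
    rw [natDegree_pow, hv, natDegree_f, ← m₀_eq]
    exact C.n_lt_m₀
  have hdpos : 0 < (v ^ C.d - C.f).natDegree := by rw [hdeg, ← m₀_eq]; exact hm
  have hN0 : v ^ C.d - C.f ≠ 0 := by
    intro h
    rw [h] at hdpos
    simp at hdpos
  have horbit : ∀ b, (v ^ C.d - C.f).IsRoot b → ∀ Q : C.Point,
      0 < Q.ord (aeval C.x (X - Polynomial.C b)) →
        Q ∈ MulAction.orbit (rootsOfUnity C.d K) P := by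
    intro b hb Q hQ
    obtain ⟨ζ, hζ⟩ := C.exists_ord_muHom_pos hc hN0
      (C.ord_pos_of_dvd (dvd_iff_isRoot.2 hb) hN0 hQ)
    have h1 := hposP (ζ⁻¹ • Q) (by rwa [ord_smul, inv_inv])
    exact ⟨ζ, by rw [← h1]; exact smul_inv_smul ζ Q⟩
  have hroot : ∀ b, (v ^ C.d - C.f).IsRoot b → 0 < P.ord (aeval C.x (X - Polynomial.C b)) := by
    intro b hb
    obtain ⟨Q, hQ⟩ := C.exists_ord_pos b
    obtain ⟨ζ, rfl⟩ := horbit b hb Q hQ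
    exact (C.ord_smul_aeval ζ P _) ▸ hQ
  obtain ⟨a, s, hs, hN⟩ := eq_C_mul_X_sub_C_pow hdpos fun b b' hb hb' =>
    C.eq_of_ord_pos (hroot b hb) (hroot b' hb')
  refine ⟨v, a, s, hs, hv, ?_, horbit a ?_⟩
  · rw [← hdeg, ← hN]; ring
  · rw [hN, IsRoot.def, eval_mul, eval_pow, eval_sub, eval_X, eval_C, eval_C, sub_self,
      zero_pow hdpos.ne', mul_zero]

/-- Two distinct packets of torsion points of order `m₀` force `d < 4`. -/
theorem d_lt_four [CharZero K] (hm₀ : C.m₀ ≠ C.n + 1) {S T : Set C.Point} (hST : S ≠ T)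
    (hS : C.IsPacket C.m₀ S) (hT : C.IsPacket C.m₀ T) : C.d < 4 := by
  obtain ⟨⟨P, rfl⟩, hSn, hSo⟩ := hS
  obtain ⟨⟨Q, rfl⟩, hTn, hTo⟩ := hT
  obtain ⟨u, a, s, hs, hu, hfu, hPa⟩ :=
    C.exists_of_nontrivial_orbit hSn (hSo P (MulAction.mem_orbit_self P))
  obtain ⟨v, b, t, ht, hv, hfv, hQb⟩ :=
    C.exists_of_nontrivial_orbit hTn (hTo Q (MulAction.mem_orbit_self Q))
  -- A point above a common value would lie in both orbits.
  have hab : a ≠ b := by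
    rintro rfl
    obtain ⟨R, hR⟩ := C.exists_ord_pos a
    exact hST ((MulAction.orbit_eq_iff.2 (hPa R hR)).symm.trans
      (MulAction.orbit_eq_iff.2 (hQb R hR)))
  have hnm := C.n_lt_m₀
  have hdn := C.d_lt_n
  have hd2 := C.two_le_d
  rw [m₀_eq] at hnm hm₀
  exact lt_four_of_pow_sub_pow hd2 (by omega) hab hs ht C.f_ne_zero
    (by rw [natDegree_f]; omega) hu hv hfu hfv

end CyclicCover

/-! ### Numerical conclusion. -/

theorem mainTheorem4 {K : Type*} [Field K] [IsAlgClosed K] [CharZero K] (C : CyclicCover K)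
    (h₀ : 0 ≤ (C.n : ℤ) - C.m₀ + C.l₀) (hm₀ : C.m₀ ≠ C.n + 1)
    (hpackets : ∃ S T : Set C.Point, S ≠ T ∧ C.IsPacket C.m₀ S ∧ C.IsPacket C.m₀ T) :
    C.d ≤ 5 ∧
    (C.n < 2 * C.d → C.d ≤ 4 ∧ C.m₀ = 2 * C.d ∧ C.n ≤ 7) ∧
    (C.n = 7 → C.d = 3) ∧
    (C.n ≠ 5 ∧ C.n ≠ 6) ∧
    (C.n = 4 → C.d = 3) ∧
    (C.n = 9 → C.d = 4) := by
  obtain ⟨S, T, hST, hS, hT⟩ := hpackets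
  have hd4 := C.d_lt_four hm₀ hST hS hT
  have hcop := C.coprime
  have hnm := C.n_lt_m₀
  have hmn := C.m₀_lt
  have hdn := C.d_lt_n
  have hd2 := C.two_le_d
  have hm := C.m₀_eq
  -- For `d = 2`, the bounds `n < m₀ < n + 2` give the excluded value `m₀ = n + 1`.
  have hd3 : C.d = 3 := by
    by_contra hne
    omega
  rw [hd3] at hcop hm hmn hdn ⊢
  have h3 : ¬ 3 ∣ C.n := fun h => by
    have := hcop.symm.eq_one_of_dvd h
    omega
  -- Now `n < m₀ < n + 3` and `m₀ ≠ n + 1` leave `m₀ = n + 2`, so `n ≡ 1 mod 3`. This rules out `5`,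
  -- `6` and `9`, and `n < 6` leaves only `n = 4`.
  omega
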